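/- **Setting.** Let $B>0$, $\mathcal Y=[-B,B]$, $\mathcal X$ a set, $n\in\mathbb N$. In round $t=1,\dots,n$ the forecaster sees $x_t\in\mathcal X$, predicts $\hat y_t\in\mathcal Y$ (possibly at random), sees $y_t\in\mathcal Y$, and incurs $\ell(\hat y_t,y_t)$, where $\ell:\mathbb R\times\mathbb R\to\mathbb R$ is convex and $L$-Lipschitz in its first argument over $\mathcal Y$. Let $\partial\ell(\hat y,y)\in[-L,L]$ denote the derivative of $\ell(\cdot,y)$ at $\hat y\in\mathcal Y$ or, where this does not exist, a fixed subderivative relative to $\mathcal Y$. Assume that for every finitely supported distribution $p$ on $\mathcal Y$ the function $\hat y\mapsto\mathbb E_{y\sim p}\,\ell(\hat y,y)$ has a minimizer over $\mathbb R$ that lies in $\mathcal Y$ and such that, if some $\ell(\cdot,y)$ with $y\in\operatorname{supp}p$ is not differentiable at it, the chosen subderivatives satisfy $\mathbb E_{y\sim p}\,\partial\ell(\cdot,y)=0$ there (so for a differentiable loss only existence of a minimizer in $\mathcal Y$ is assumed). Let $\phi:(\mathcal X\times\mathcal Y)^n\to\mathbb R$. Let $\mathcal T$ be a real vector space, $\mathbf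 T:\mathcal X\times\mathcal Y\times[-L,L]\to\mathcal T$ and $V:\mathcal T\to\mathbb R$ such that $\sum_{t=1}^n\ell(\hat y_t,y_t)-\phi(x_1,y_1,\dots,x_n,y_n)\le V\big(\sum_{t=1}^n\mathbf T(x_t,\hat y_t,\partial\ell(\hat y_t,y_t))\big)$ for all sequences $(x_t,\hat y_t,y_t)_{t\le n}$ in $\mathcal X\times\mathcal Y\times\mathcal Y$. Let $\mathbf U:\mathcal T\to\mathbb R$ be a Burkholder function for $(\mathbf T,V)$, that is: $\mathbf U(0)\le0$; $\mathbf U\ge V$; and either (a) $\mathbb E_{\alpha\sim p}\mathbf U(\tau+\mathbf T(x,\hat y,\alpha))\le\mathbf U(\tau)$ for all $\tau\in\mathcal T$, $(x,\hat y)\in\mathcal X\times\mathcal Y$ and every mean-zero Borel probability measure $p$ on $[-L,L]$ for which the expectation exists, or (b) for all such $\tau,x,\hat y$ the map $\alpha\mapsto\mathbf U(\tau+\mathbf T(x,\hat y,\alpha))$ is convex on $[-L,L]$ and $\tfrac12\mathbf U(\tau+\mathbf T(x,\hat y,L))+\tfrac12\mathbf U(\tau+\mathbf T(x,\hat y,-L))\le\mathbf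 U(\tau)$. Write $\zeta_t=\sum_{s=1}^t\mathbf T(x_s,\hat y_s,\partial\ell(\hat y_s,y_s))$ and $F_{\zeta,x}(\hat y,y)=\mathbf U(\zeta+\mathbf T(x,\hat y,\partial\ell(\hat y,y)))$. Assume there are constants $K_t,H_t$ such that for every $t\le n$, every value $\zeta_{t-1}$ that some sequence $(x_s,\hat y_s,y_s)_{s<t}$ in $\mathcal X\times\mathcal Y\times\mathcal Y$ produces, all $x_t\in\mathcal X$ and $y\in\mathcal Y$, the map $\hat y\mapsto F_{\zeta_{t-1},x_t}(\hat y,y)$ on $\mathcal Y$ is $K_t$-Lipschitz and bounded in magnitude by $H_t$. **Strategy.** Fix $\varepsilon_1>0$, $\varepsilon_2\ge0$, $N=\lceil 2B/\varepsilon_1\rceil$ and control points $z_i=\min\{B,-B+\varepsilon_1 i\}$, $1\le i\le N$. In round $t$ let $\hat\mu_t$ be any element of the simplex $\Delta_N$ that solves $$\min_{\mu\in\Delta_N}\ \sup_{y\in\mathcal Y}\ \sum_{i=1}^N\mu_i\,F_{\zeta_{t-1},x_t}(z_i,y)$$ up to additive precision $\varepsilon_2$ ($\hat\mu_t$ may depend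 on the whole past), and draw $\hat y_t$ from $\{z_1,\dots,z_N\}$ with these weights. **Proposition.** (1) For every sequence $(x_1,y_1),\dots,(x_n,y_n)$ in $\mathcal X\times\mathcal Y$ the strategy guarantees $$\mathbb E\Big[\sum_{t=1}^n\ell(\hat y_t,y_t)\Big]-\phi(x_1,y_1,\dots,x_n,y_n)\le\varepsilon_1\sum_{t=1}^nK_t+\varepsilon_2 n .$$ (2) Suppose moreover that $n\ge1$, $K_t=K>0$ and $H_t=H\geq 0$ for all $t$, and that either all maps $y\mapsto F_{\zeta_{t-1},x_t}(\hat y,y)$ on $\mathcal Y$ ($t\le n$, $\zeta_{t-1}$ as above, $x_t\in\mathcal X$, $\hat y\in\mathcal Y$) are $K$-Lipschitz or all of them are convex. Take $\varepsilon_1=1/(Kn)$, $\varepsilon_2=1/n$. Then the strategy can be implemented so that the left-hand side in (1) is at most $2$ for every sequence and the total running time over the $n$ rounds is at most $C\,\big((1+B)(1+K)(1+H)\,n\big)^{d}$, where the program and the integers $C,d$ are universal (the same for all problems). Here the program is one for a real-number random access machine with inputs $B,K,H,\varepsilon_1,\varepsilon_2$; arithmetic operations and comparisons on reals, memory accesses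 and evaluations of $F_{\zeta_{t-1},x_t}(\hat y,y)$ take one step each, drawing from a list of $N$ weights takes $N$ steps, and the update of $\zeta_t$ takes one step. -/

import Mathlib

universe u v

/-! ### Online supervised learning -/

/-- An online supervised learning problem with side information in `X` and outcomes and predictions
in the interval `[-B, B]`. `phi` is the right-hand side of the desired bound on the cumulative loss;
it is only used on data sequences of length `n`. -/
structure OnlineProblem (X : Type u) where
  /-- number of rounds -/
  n : ℕ
  /-- outcomes and predictions lie in `[-B, B]` -/
  B : ℝ
  /-- Lipschitz constant of the loss -/
  L : ℝ
  /-- `loss z y`: loss of the prediction `z` for the outcome `y` -/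
  loss : ℝ → ℝ → ℝ
  /-- `dloss z y`: derivative, or a chosen subderivative, of `loss · y` at `z` -/
  dloss : ℝ → ℝ → ℝ
  phi : List (X × ℝ) → ℝ
  B_pos : 0 < B
  convex_loss : ∀ y ∈ Set.Icc (-B) B, ConvexOn ℝ (Set.Icc (-B) B) (fun z => loss z y)
  lipschitz_loss : ∀ y ∈ Set.Icc (-B) B, ∀ a ∈ Set.Icc (-B) B, ∀ b ∈ Set.Icc (-B) B,
    |loss a y - loss b y| ≤ L * |a - b|
  dloss_mem : ∀ z ∈ Set.Icc (-B) B, ∀ y ∈ Set.Icc (-B) B, dloss z y ∈ Set.Icc (-L) L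
  /-- where the loss is differentiable, `dloss` is its derivative -/
  dloss_eq_deriv : ∀ z ∈ Set.Icc (-B) B, ∀ y ∈ Set.Icc (-B) B,
    DifferentiableAt ℝ (fun w => loss w y) z → dloss z y = deriv (fun w => loss w y) z
  /-- `dloss` is always a subderivative -/
  dloss_subderiv : ∀ z ∈ Set.Icc (-B) B, ∀ y ∈ Set.Icc (-B) B, ∀ w ∈ Set.Icc (-B) B,
    loss z y + dloss z y * (w - z) ≤ loss w y
  /-- For every distribution with finite support `s ⊆ [-B, B]`, the expected loss has a global
  minimizer that lies in `[-B, B]`; if the loss has a kink there, then the chosen subderivatives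
  have mean zero there. (The second part is void for a differentiable loss.) -/
  exists_minimizer : ∀ (s : Finset ℝ) (p : ℝ → ℝ), (s : Set ℝ) ⊆ Set.Icc (-B) B →
    (∀ y ∈ s, 0 < p y) → ∑ y ∈ s, p y = 1 →
    ∃ z ∈ Set.Icc (-B) B, (∀ w : ℝ, ∑ y ∈ s, p y * loss z y ≤ ∑ y ∈ s, p y * loss w y) ∧
      ((∀ y ∈ s, DifferentiableAt ℝ (fun w => loss w y) z) ∨ ∑ y ∈ s, p y * dloss z y = 0)

/-- A transcript: the list, in chronological order, of the triples
(side information, prediction, outcome) of the rounds played so far. -/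
abbrev Transcript (X : Type u) : Type u := List (X × ℝ × ℝ)

namespace OnlineProblem

variable {X : Type u} {S : Type v} [AddCommGroup S] [Module ℝ S]

/-- The common set of outcomes and predictions. -/
def Y (P : OnlineProblem X) : Set ℝ := Set.Icc (-P.B) P.B

/-- All predictions and outcomes of the transcript lie in `[-B, B]`. -/
def Valid (P : OnlineProblem X) (h : Transcript X) : Prop :=
  ∀ e ∈ h, e.2.1 ∈ P.Y ∧ e.2.2 ∈ P.Y

/-- Cumulative loss of the predictions of a transcript. -/
def totalLoss (P : OnlineProblem X) (h : Transcript X) : ℝ :=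
  (h.map fun e => P.loss e.2.1 e.2.2).sum

/-- Cumulative value of the statistic `T` on a transcript. -/
def stat (P : OnlineProblem X) (T : X → ℝ → ℝ → S) (h : Transcript X) : S :=
  (h.map fun e => T e.1 e.2.1 (P.dloss e.2.1 e.2.2)).sum

/-- `(T, V)` is an additive sufficient statistic pair for `phi`. -/
def IsSufficientPair (P : OnlineProblem X) (T : X → ℝ → ℝ → S) (V : S → ℝ) : Prop :=
  ∀ h : Transcript X, h.length = P.n → P.Valid h →
    P.totalLoss h - P.phi (h.map fun e => (e.1, e.2.2)) ≤ V (P.stat T h)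

/-- Restricted concavity, for every mean-zero Borel probability measure on `[-L, L]` for which the
expectation of `U` exists. -/
def RestrictedConcave (P : OnlineProblem X) (T : X → ℝ → ℝ → S) (U : S → ℝ) : Prop :=
  ∀ (τ : S) (x : X), ∀ z ∈ P.Y, ∀ p : MeasureTheory.Measure ℝ,
    MeasureTheory.IsProbabilityMeasure p → (∀ᵐ α ∂p, α ∈ Set.Icc (-P.L) P.L) →
    ∫ α, α ∂p = 0 → MeasureTheory.Integrable (fun α => U (τ + T x z α)) p →
    ∫ α, U (τ + T x z α) ∂p ≤ U τ

/-- The variant of restricted concavity for Rademacher signs, with convexity of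
`α ↦ U (τ + T x z α)` on `[-L, L]`. -/
def RademacherConcave (P : OnlineProblem X) (T : X → ℝ → ℝ → S) (U : S → ℝ) : Prop :=
  ∀ (τ : S) (x : X), ∀ z ∈ P.Y,
    ConvexOn ℝ (Set.Icc (-P.L) P.L) (fun α => U (τ + T x z α)) ∧
    (U (τ + T x z P.L) + U (τ + T x z (-P.L))) / 2 ≤ U τ

/-- `U` is a Burkholder function for `(T, V)`. -/
def IsBurkholder (P : OnlineProblem X) (T : X → ℝ → ℝ → S) (V U : S → ℝ) : Prop :=
  U 0 ≤ 0 ∧ (∀ τ, V τ ≤ U τ) ∧ (P.RestrictedConcave T U ∨ P.RademacherConcave T U)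

/-- Value of `U` after one more round with side information `x`, prediction `z`, outcome `y`,
when the cumulative statistic before the round is `ζ`. -/
def next (P : OnlineProblem X) (T : X → ℝ → ℝ → S) (U : S → ℝ) (ζ : S) (x : X) (z y : ℝ) : ℝ :=
  U (ζ + T x z (P.dloss z y))

/-- In each round `t = 1, …, n`, the value of `U` after the round is, as a function of the
prediction, `K t`-Lipschitz and bounded by `H t`, for every outcome, every side information and
every cumulative statistic that the first `t - 1` rounds can produce. -/
def LipschitzBounded (P : OnlineProblem X) (T : X → ℝ → ℝ → S) (U : S → ℝ) (K H : ℕ → ℝ) : Prop :=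
  ∀ t ∈ Finset.Icc 1 P.n, ∀ h : Transcript X, h.length + 1 = t → P.Valid h →
    ∀ x : X, ∀ y ∈ P.Y,
      (∀ a ∈ P.Y, ∀ b ∈ P.Y,
        |P.next T U (P.stat T h) x a y - P.next T U (P.stat T h) x b y| ≤ K t * |a - b|) ∧
      ∀ a ∈ P.Y, |P.next T U (P.stat T h) x a y| ≤ H t

/-- As a function of the outcome, the value of `U` after each round is `K`-Lipschitz. -/
def OutcomeLipschitz (P : OnlineProblem X) (T : X → ℝ → ℝ → S) (U : S → ℝ) (K : ℝ) : Prop :=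
  ∀ h : Transcript X, h.length < P.n → P.Valid h → ∀ x : X, ∀ z ∈ P.Y, ∀ a ∈ P.Y, ∀ b ∈ P.Y,
    |P.next T U (P.stat T h) x z a - P.next T U (P.stat T h) x z b| ≤ K * |a - b|

/-- As a function of the outcome, the value of `U` after each round is convex. -/
def OutcomeConvex (P : OnlineProblem X) (T : X → ℝ → ℝ → S) (U : S → ℝ) : Prop :=
  ∀ h : Transcript X, h.length < P.n → P.Valid h → ∀ x : X, ∀ z ∈ P.Y,
    ConvexOn ℝ P.Y (fun y => P.next T U (P.stat T h) x z y)

end OnlineProblem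

/-! ### The discretized strategy -/

/-- Number of control points for spacing `ε`. -/
noncomputable def gridSize (B ε : ℝ) : ℕ := ⌈2 * B / ε⌉₊

/-- The control points `-B + ε i` for `i = 1, …, gridSize B ε` (here `i` is shifted by one), where
the last one is moved to `B` if it would leave `[-B, B]`. -/
noncomputable def gridPoint (B ε : ℝ) (i : Fin (gridSize B ε)) : ℝ :=
  min B (-B + ε * ((i : ℝ) + 1))

/-- Objective function of the finite convex program: the worst case over the outcomes of the
expectation of `F` when the prediction is drawn from the weights `μ` on the control points. -/
noncomputable def gridObjective (B ε : ℝ) (F : ℝ → ℝ → ℝ) (μ : Fin (gridSize B ε) → ℝ) : ℝ :=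
  ⨆ y : Set.Icc (-B) B, ∑ i, μ i * F (gridPoint B ε i) y

/-- `μ` minimizes the objective function over the simplex up to additive precision `ε₂`. -/
def IsApproxSolution (B ε₁ ε₂ : ℝ) (F : ℝ → ℝ → ℝ) (μ : Fin (gridSize B ε₁) → ℝ) : Prop :=
  μ ∈ stdSimplex ℝ (Fin (gridSize B ε₁)) ∧
    ∀ ν ∈ stdSimplex ℝ (Fin (gridSize B ε₁)),
      gridObjective B ε₁ F μ ≤ gridObjective B ε₁ F ν + ε₂

/-- A randomized strategy on `N` control points: from the transcript of the past and the current
side information, it computes the weights from which the prediction is drawn. -/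
abbrev GridStrategy (X : Type u) (N : ℕ) : Type u := Transcript X → X → Fin N → ℝ

namespace OnlineProblem

variable {X : Type u} {S : Type v} [AddCommGroup S] [Module ℝ S]

/-- The strategy plays, in every round, an `ε₂`-precise solution of the finite convex program. -/
def IsDiscretizedBurkholder (P : OnlineProblem X) (T : X → ℝ → ℝ → S) (U : S → ℝ) (ε₁ ε₂ : ℝ)
    (σ : GridStrategy X (gridSize P.B ε₁)) : Prop :=
  ∀ h : Transcript X, h.length < P.n → P.Valid h → ∀ x : X,
    IsApproxSolution P.B ε₁ ε₂ (P.next T U (P.stat T h) x) (σ h x)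

/-- Expectation of a function `f` of the final transcript, when the rounds of the transcript `h`
have been played, the remaining data are the listed pairs (side information, outcome), and the
remaining predictions are drawn by the strategy, one after the other. -/
noncomputable def expectation (P : OnlineProblem X) (ε₁ : ℝ)
    (σ : GridStrategy X (gridSize P.B ε₁)) (f : Transcript X → ℝ) :
    Transcript X → List (X × ℝ) → ℝ
  | h, [] => f h
  | h, e :: rest =>
      ∑ i, σ h e.1 i * expectation P ε₁ σ f (h ++ [(e.1, gridPoint P.B ε₁ i, e.2)]) rest

/-- For every data sequence, the expected cumulative loss of the strategy exceeds `phi` by at most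
`slack`. -/
def RegretAtMost (P : OnlineProblem X) (ε₁ : ℝ)
    (σ : GridStrategy X (gridSize P.B ε₁)) (slack : ℝ) : Prop :=
  ∀ data : List (X × ℝ), data.length = P.n → (∀ e ∈ data, e.2 ∈ P.Y) →
    P.expectation ε₁ σ P.totalLoss [] data - P.phi data ≤ slack

end OnlineProblem

/-! ### A real random access machine with an oracle

Programs of a small imperative language over integer registers and an array of reals. Arithmetic
operations and comparisons on exact reals, memory accesses, and calls of the oracle, a function of
two reals, take unit time. -/

/-- Index expressions. -/
inductive IdxExpr where
  | const (k : ℕ)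
  | reg (r : ℕ)
  | add (a b : IdxExpr)
  | sub (a b : IdxExpr)

/-- Real expressions; `load a` reads the array at index `a`, `oracle a b` calls the oracle. -/
inductive RealExpr where
  | ofIdx (a : IdxExpr)
  | load (a : IdxExpr)
  | add (a b : RealExpr)
  | sub (a b : RealExpr)
  | mul (a b : RealExpr)
  | div (a b : RealExpr)
  | oracle (a b : RealExpr)

/-- Tests. -/
inductive TestExpr where
  | idxLt (a b : IdxExpr)
  | realLt (a b : RealExpr)

/-- Programs. -/
inductive Program where
  | skip
  | setReg (r : ℕ) (e : IdxExpr)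
  | store (a : IdxExpr) (e : RealExpr)
  | seq (c₁ c₂ : Program)
  | ite (b : TestExpr) (c₁ c₂ : Program)
  | loop (b : TestExpr) (c : Program)

/-- Memory of the machine. -/
structure MachineState where
  /-- integer registers -/
  regs : ℕ → ℕ
  /-- array of reals -/
  mem : ℕ → ℝ

/-- Value of an index expression (subtraction is truncated at zero). -/
def IdxExpr.eval (s : MachineState) : IdxExpr → ℕ
  | .const k => k
  | .reg r => s.regs r
  | .add a b => a.eval s + b.eval s
  | .sub a b => a.eval s - b.eval s

/-- Number of operations in an index expression. -/
def IdxExpr.cost : IdxExpr → ℕ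
  | .const _ => 1
  | .reg _ => 1
  | .add a b => a.cost + b.cost + 1
  | .sub a b => a.cost + b.cost + 1

/-- Value of a real expression with oracle `F`. -/
noncomputable def RealExpr.eval (F : ℝ → ℝ → ℝ) (s : MachineState) : RealExpr → ℝ
  | .ofIdx a => (a.eval s : ℝ)
  | .load a => s.mem (a.eval s)
  | .add a b => a.eval F s + b.eval F s
  | .sub a b => a.eval F s - b.eval F s
  | .mul a b => a.eval F s * b.eval F s
  | .div a b => a.eval F s / b.eval F s
  | .oracle a b => F (a.eval F s) (b.eval F s)

/-- Number of operations in a real expression. -/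
def RealExpr.cost : RealExpr → ℕ
  | .ofIdx a => a.cost + 1
  | .load a => a.cost + 1
  | .add a b => a.cost + b.cost + 1
  | .sub a b => a.cost + b.cost + 1
  | .mul a b => a.cost + b.cost + 1
  | .div a b => a.cost + b.cost + 1
  | .oracle a b => a.cost + b.cost + 1

/-- Truth of a test with oracle `F`. -/
def TestExpr.holds (F : ℝ → ℝ → ℝ) (s : MachineState) : TestExpr → Prop
  | .idxLt a b => a.eval s < b.eval s
  | .realLt a b => a.eval F s < b.eval F s

/-- Number of operations in a test. -/
def TestExpr.cost : TestExpr → ℕ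
  | .idxLt a b => a.cost + b.cost + 1
  | .realLt a b => a.cost + b.cost + 1

/-- `Exec F c s k s'`: with oracle `F`, the program `c` started in state `s` halts in state `s'`
after `k` steps. -/
inductive Exec (F : ℝ → ℝ → ℝ) : Program → MachineState → ℕ → MachineState → Prop where
  | skip (s : MachineState) : Exec F .skip s 1 s
  | setReg (r : ℕ) (e : IdxExpr) (s : MachineState) :
      Exec F (.setReg r e) s (e.cost + 1) { s with regs := Function.update s.regs r (e.eval s) }
  | store (a : IdxExpr) (e : RealExpr) (s : MachineState) :
      Exec F (.store a e) s (a.cost + e.cost + 1)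
        { s with mem := Function.update s.mem (a.eval s) (e.eval F s) }
  | seq {c₁ c₂ : Program} {s s₁ s₂ : MachineState} {k₁ k₂ : ℕ} :
      Exec F c₁ s k₁ s₁ → Exec F c₂ s₁ k₂ s₂ → Exec F (.seq c₁ c₂) s (k₁ + k₂) s₂
  | iteTrue {b : TestExpr} {c₁ c₂ : Program} {s s' : MachineState} {k : ℕ} :
      b.holds F s → Exec F c₁ s k s' → Exec F (.ite b c₁ c₂) s (b.cost + k + 1) s'
  | iteFalse {b : TestExpr} {c₁ c₂ : Program} {s s' : MachineState} {k : ℕ} :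
      ¬ b.holds F s → Exec F c₂ s k s' → Exec F (.ite b c₁ c₂) s (b.cost + k + 1) s'
  | loopTrue {b : TestExpr} {c : Program} {s s₁ s₂ : MachineState} {k₁ k₂ : ℕ} :
      b.holds F s → Exec F c s k₁ s₁ → Exec F (.loop b c) s₁ k₂ s₂ →
      Exec F (.loop b c) s (b.cost + k₁ + k₂ + 1) s₂
  | loopFalse {b : TestExpr} {c : Program} {s : MachineState} :
      ¬ b.holds F s → Exec F (.loop b c) s (b.cost + 1) s

/-- Initial state: the listed inputs at the beginning of the array, and zero everywhere else. -/
def initialState (inputs : List ℝ) : MachineState where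
  regs := fun _ => 0
  mem := fun j => inputs.getD j 0

/-- With oracle `F`, on the given inputs, the program halts after `k` steps, with `μ` written at
the beginning of the array. -/
def ComputesIn (c : Program) (F : ℝ → ℝ → ℝ) (inputs : List ℝ) (k : ℕ) {N : ℕ}
    (μ : Fin N → ℝ) : Prop :=
  ∃ s' : MachineState, Exec F c (initialState inputs) k s' ∧ ∀ i : Fin N, s'.mem i = μ i

/-- The strategy is implemented by the program `c` on the given inputs in at most `τ` steps per
round. A round consists of the computation of the weights with the oracle `next` (evaluation of
`U`), which costs `k` steps, of drawing the prediction from these weights, which costs as many steps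
as there are control points, and of one step for the update of the cumulative statistic. -/
def OnlineProblem.ImplementedIn {X : Type u} {S : Type v} [AddCommGroup S] [Module ℝ S]
    (P : OnlineProblem X) (T : X → ℝ → ℝ → S) (U : S → ℝ) (ε₁ : ℝ)
    (σ : GridStrategy X (gridSize P.B ε₁)) (c : Program) (inputs : List ℝ) (τ : ℕ) : Prop :=
  ∀ h : Transcript X, h.length < P.n → P.Valid h → ∀ x : X,
    ∃ k : ℕ, k + gridSize P.B ε₁ + 1 ≤ τ ∧
      ComputesIn c (P.next T U (P.stat T h) x) inputs k (σ h x)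

/-! The regret bound is a potential argument. By sufficiency and `V ≤ U`, the final excess loss is
at most `U` of the final statistic, and `U 0 ≤ 0`. So it suffices that in round `t` the conditional
expectation of `U` grows by at most `ε₁ * K t + ε₂`, whatever the outcome
(`IsBurkholder.sum_next_le`); `expectation_sub_phi_le` adds these errors up.

For a single round, exchange the order of the players. Against a known finitely supported law of
outcomes, predict a minimizer of the expected loss: the subderivatives there have mean zero, so the
concavity property of `U` says that `U` does not increase on average
(`IsBurkholder.exists_sum_next_le`). Rounding this prediction to a control point costs `ε₁ * K t`.
The minimax theorem turns these replies into one mixed prediction that is good against all outcomes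
at once, and an `ε₂`-precise solution is worse by at most `ε₂`.

The minimax theorem is proved by regret matching, so that one analysis serves both the existence
statement and the algorithm. Weights proportional to the positive parts of the cumulative regrets
are played against nearly best replies. The sum of squares of these positive parts grows at most
linearly (`RegretState.step`), hence the average regret tends to zero and the average mixed action
is nearly optimal (`RegretState.bound`).

The program runs regret matching on `N` control points against the `2N + 1` equally spaced outcomes
`B j / N - B`. By the Lipschitz or convexity assumption in the outcome, this restriction loses at
most `ε₂ / 2` (`exists_le_add_of_lipschitz_or_convex`), and `matchingRounds` rounds push the average
regret below the other `ε₂ / 2`. Correctness and step counts are derived together through the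
predicate `Ends`; for the chosen precisions `matching_time_le` bounds the total polynomially. -/

/-! ### Regret matching -/

/-- The state of regret matching after `t` rounds against approximate best responses: `A` is the sum
of the mixed actions played, `R` the vector of cumulative regrets. -/
def RegretState {N : ℕ} {ι : Type*} (F : Fin N → ι → ℝ) (H δ : ℝ) (t : ℕ) (A R : Fin N → ℝ) :
    Prop :=
  (∀ i, 0 ≤ A i) ∧ ∑ i, A i = t ∧ ∑ i, (max (R i) 0) ^ 2 ≤ 4 * H ^ 2 * N * t ∧
    -- In a run, `W` is the payoff accumulated so far and `ys` collects the replies. They are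
    -- existentially hidden because the program stores only `A` and `R`.
    ∃ (W : ℝ) (ys : Multiset ι), ys.card = t ∧ (∀ i, R i = W - (ys.map (F i)).sum) ∧
      ∀ y, ∑ i, A i * F i y ≤ W + δ * t

theorem RegretState.zero {N : ℕ} {ι : Type*} (F : Fin N → ι → ℝ) (H δ : ℝ) :
    RegretState F H δ 0 (fun _ => 0) (fun _ => 0) :=
  ⟨fun _ => le_rfl, by simp, by simp, 0, 0, by simp, by simp, by simp⟩

theorem abs_weighted_sum_le {N : ℕ} {μ f : Fin N → ℝ} {H : ℝ}
    (hμ : μ ∈ stdSimplex ℝ (Fin N)) (hf : ∀ i, |f i| ≤ H) : |∑ i, μ i * f i| ≤ H := by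
  calc |∑ i, μ i * f i| ≤ ∑ i, |μ i * f i| := Finset.abs_sum_le_sum_abs _ _
    _ ≤ ∑ i, μ i * H := Finset.sum_le_sum fun i _ => by
        rw [abs_mul, abs_of_nonneg (hμ.1 i)]
        exact mul_le_mul_of_nonneg_left (hf i) (hμ.1 i)
    _ = H := by rw [← Finset.sum_mul, hμ.2, one_mul]

/-- Growth of the potential in one coordinate. Since `a + b ≤ max a 0 + b`, the positive part on the
left is at most `|max a 0 + b|`. The cross term is the one that regret matching cancels after
summation. -/
theorem sq_max_add_le (a b : ℝ) : (max (a + b) 0) ^ 2 ≤ (max a 0) ^ 2 + 2 * (max a 0 * b) + b ^ 2 := by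
  have h1 : max (a + b) 0 ≤ |max a 0 + b| := by
    apply max_le _ (abs_nonneg _)
    exact (add_le_add_left (le_max_left a 0) b).trans (le_abs_self _)
  calc (max (a + b) 0) ^ 2 ≤ |max a 0 + b| ^ 2 := pow_le_pow_left₀ (le_max_right _ _) h1 2
    _ = _ := by rw [sq_abs]; ring

/-- One round of regret matching: `μ` is proportional to the positive parts of the regrets, and `y`
is a best response to it up to `δ`. -/
theorem RegretState.step {N : ℕ} {ι : Type*} {F : Fin N → ι → ℝ} {H δ : ℝ} {t : ℕ}
    {A R : Fin N → ℝ} (h : RegretState F H δ t A R) (hF : ∀ i y, |F i y| ≤ H) {μ : Fin N → ℝ}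
    (hμ : μ ∈ stdSimplex ℝ (Fin N)) {S : ℝ} (hS : ∀ i, max (R i) 0 = S * μ i) {y : ι}
    (hy : ∀ y', ∑ i, μ i * F i y' ≤ ∑ i, μ i * F i y + δ) :
    RegretState F H δ (t + 1) (fun i => A i + μ i)
      (fun i => R i + (∑ k, μ k * F k y - F i y)) := by
  obtain ⟨hA, hAt, hR, W, ys, hc, hW, hV⟩ := h
  set v := ∑ k, μ k * F k y with hv
  have hvH : |v| ≤ H := abs_weighted_sum_le hμ fun i => hF i y
  refine ⟨fun i => add_nonneg (hA i) (hμ.1 i), ?_, ?_, W + v, y ::ₘ ys, by simp [hc], ?_, ?_⟩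
  · rw [Finset.sum_add_distrib, hAt, hμ.2]; push_cast; rfl
  -- The weights are proportional to the positive regrets, and the instantaneous regrets `v - F i y`
  -- average to zero under `μ`.
  · have hz : ∑ i, max (R i) 0 * (v - F i y) = 0 := by
      have : ∑ i, max (R i) 0 * (v - F i y) = S * (v * ∑ i, μ i - ∑ i, μ i * F i y) := by
        rw [Finset.mul_sum, ← Finset.sum_sub_distrib, Finset.mul_sum]
        exact Finset.sum_congr rfl fun i _ => by rw [hS i]; ring
      rw [this, hμ.2, ← hv]; ring
    have hb : ∑ i, (v - F i y) ^ 2 ≤ 4 * H ^ 2 * N := by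
      calc ∑ i, (v - F i y) ^ 2 ≤ ∑ _i : Fin N, (2 * H) ^ 2 := Finset.sum_le_sum fun i _ => by
            apply sq_le_sq'
            · have := (abs_le.1 hvH).1; have := (abs_le.1 (hF i y)).2; linarith
            · have := (abs_le.1 hvH).2; have := (abs_le.1 (hF i y)).1; linarith
        _ = _ := by simp; ring
    calc ∑ i, (max (R i + (v - F i y)) 0) ^ 2
        ≤ ∑ i, ((max (R i) 0) ^ 2 + 2 * (max (R i) 0 * (v - F i y)) + (v - F i y) ^ 2) :=
          Finset.sum_le_sum fun i _ => sq_max_add_le _ _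
      _ = ∑ i, (max (R i) 0) ^ 2 + 2 * ∑ i, max (R i) 0 * (v - F i y) + ∑ i, (v - F i y) ^ 2 := by
          rw [Finset.sum_add_distrib, Finset.sum_add_distrib, Finset.mul_sum]
      _ ≤ 4 * H ^ 2 * N * ((t + 1 : ℕ) : ℝ) := by rw [hz]; push_cast; linarith
  · intro i
    rw [Multiset.map_cons, Multiset.sum_cons]
    linarith [hW i]
  · intro y'
    simp only [add_mul, Finset.sum_add_distrib]
    have := hV y'
    have := hy y'
    push_cast
    linarith

/-- The average mixed action is nearly optimal. -/
theorem RegretState.bound {N : ℕ} {ι : Type*} {F : Fin N → ι → ℝ} {H δ η : ℝ} {t : ℕ}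
    {A R : Fin N → ℝ} (h : RegretState F H δ t A R) (hη : 0 ≤ η)
    (ht : 4 * H ^ 2 * N ≤ η ^ 2 * t) :
    ∃ ys : Multiset ι, ys.card = t ∧
      ∀ i y, ∑ k, A k * F k y ≤ (ys.map (F i)).sum + (δ + η) * t := by
  obtain ⟨-, -, hR, W, ys, hc, hW, hV⟩ := h
  refine ⟨ys, hc, fun i y => ?_⟩
  -- A single squared regret is at most the whole potential, which is linear in `t`, so the regret
  -- itself is of order `√t`.
  have h1 : (max (R i) 0) ^ 2 ≤ (η * t) ^ 2 := by
    calc (max (R i) 0) ^ 2 ≤ ∑ i, (max (R i) 0) ^ 2 :=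
          Finset.single_le_sum (f := fun i => (max (R i) 0) ^ 2) (fun _ _ => sq_nonneg _)
            (Finset.mem_univ i)
      _ ≤ 4 * H ^ 2 * N * t := hR
      _ ≤ η ^ 2 * t * t := mul_le_mul_of_nonneg_right ht (Nat.cast_nonneg t)
      _ = (η * t) ^ 2 := by ring
  have h2 : R i ≤ η * t :=
    (le_max_left _ _).trans (le_of_sq_le_sq h1 (by positivity))
  have := hV y
  have := hW i
  linarith

theorem RegretState.average_mem {N : ℕ} {ι : Type*} {F : Fin N → ι → ℝ} {H δ : ℝ} {t : ℕ}
    {A R : Fin N → ℝ} (h : RegretState F H δ t A R) (ht : 0 < t) :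
    (fun i => A i / t) ∈ stdSimplex ℝ (Fin N) := by
  refine ⟨fun i => div_nonneg (h.1 i) (Nat.cast_nonneg t), ?_⟩
  rw [← Finset.sum_div, h.2.1, div_self (by positivity)]

/-- If no regret is positive, any mixed action is admissible, with factor `S = 0`. -/
theorem exists_regretMatching_weights {N : ℕ} (hN : 0 < N) (R : Fin N → ℝ) :
    ∃ μ ∈ stdSimplex ℝ (Fin N), ∃ S : ℝ, ∀ i, max (R i) 0 = S * μ i := by
  have h0 : ∀ i ∈ Finset.univ, 0 ≤ max (R i) 0 := fun i _ => le_max_right _ _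
  rcases (Finset.sum_nonneg h0).eq_or_lt with h | h
  · refine ⟨Pi.single ⟨0, hN⟩ 1, single_mem_stdSimplex _ _, 0, fun i => ?_⟩
    rw [zero_mul]
    exact (Finset.sum_eq_zero_iff_of_nonneg h0).1 h.symm i (Finset.mem_univ i)
  · refine ⟨fun i => max (R i) 0 / ∑ i, max (R i) 0, ⟨fun i => ?_, ?_⟩, ∑ i, max (R i) 0, fun i => ?_⟩
    · exact div_nonneg (h0 i (Finset.mem_univ i)) h.le
    · rw [← Finset.sum_div, div_self h.ne']
    · rw [mul_div_cancel₀ _ h.ne']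

/-- The set of replies may be infinite and the supremum not attained, which is why replies are
optimal only up to `δ > 0`. -/
theorem exists_regretState {N : ℕ} (hN : 0 < N) {ι : Type*} [Nonempty ι] {F : Fin N → ι → ℝ}
    {H δ : ℝ} (hF : ∀ i y, |F i y| ≤ H) (hδ : 0 < δ) (t : ℕ) : ∃ A R, RegretState F H δ t A R := by
  induction t with
  | zero => exact ⟨_, _, RegretState.zero F H δ⟩
  | succ t ih =>
    obtain ⟨A, R, h⟩ := ih
    obtain ⟨μ, hμ, S, hS⟩ := exists_regretMatching_weights hN R
    have hb : BddAbove (Set.range fun y => ∑ i, μ i * F i y) :=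
      ⟨H, by rintro _ ⟨y, rfl⟩; exact (abs_le.1 (abs_weighted_sum_le hμ fun i => hF i y)).2⟩
    obtain ⟨y, hy⟩ := exists_lt_of_lt_ciSup (sub_lt_self (⨆ y, ∑ i, μ i * F i y) hδ)
    exact ⟨_, _, h.step hF hμ hS (y := y) fun y' => by 
      linarith [le_ciSup hb y']⟩

/-- The minimax theorem for bounded games with finitely many actions of the minimizing player,
against finitely supported mixed actions with rational weights. -/
theorem exists_mem_stdSimplex_forall_le {N : ℕ} (hN : 0 < N) {ι : Type*} [Nonempty ι]
    {F : Fin N → ι → ℝ} {H c δ : ℝ} (hF : ∀ i y, |F i y| ≤ H) (hδ : 0 < δ)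
    (hc : ∀ ys : Multiset ι, ys ≠ 0 → ∃ i, (ys.map (F i)).sum ≤ c * ys.card) :
    ∃ μ ∈ stdSimplex ℝ (Fin N), ∀ y, ∑ i, μ i * F i y ≤ c + δ := by
  -- Half of `δ` pays for inexact replies, the other half for the average regret after `t` rounds.
  obtain ⟨t, ht⟩ := exists_nat_gt (4 * H ^ 2 * N / (δ / 2) ^ 2)
  have ht0 : 0 < t := by
    have : (0 : ℝ) ≤ 4 * H ^ 2 * N / (δ / 2) ^ 2 := by positivity
    exact_mod_cast this.trans_lt ht
  obtain ⟨A, R, h⟩ := exists_regretState hN hF (half_pos hδ) t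
  obtain ⟨ys, hys, hb⟩ := h.bound (half_pos hδ).le (by
    rw [div_lt_iff₀ (by positivity)] at ht; linarith)
  obtain ⟨i, hi⟩ := hc ys (by rw [← Multiset.card_pos, hys]; exact ht0)
  refine ⟨_, h.average_mem ht0, fun y => ?_⟩
  have ht0' : (0 : ℝ) < t := by exact_mod_cast ht0
  have : ∑ i, A i / t * F i y = (∑ i, A i * F i y) / t := by
    rw [Finset.sum_div]; exact Finset.sum_congr rfl fun i _ => by ring
  rw [this, div_le_iff₀ ht0']
  have := hb i y
  rw [hys] at hi
  linarith

/-! ### The regret inequality -/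

namespace OnlineProblem

variable {X : Type u} {S : Type v} [AddCommGroup S]

/-- The law is realized as a weighted sum of Dirac measures. Every real function is integrable
against it, so no measurability of `U` is needed. -/
theorem RestrictedConcave.sum_le {P : OnlineProblem X} {T : X → ℝ → ℝ → S} {U : S → ℝ}
    (hU : P.RestrictedConcave T U) (τ : S) (x : X) {z : ℝ} (hz : z ∈ P.Y) {κ : Type*}
    (s : Finset κ) (p α : κ → ℝ) (hp : ∀ k ∈ s, 0 ≤ p k) (hp1 : ∑ k ∈ s, p k = 1)
    (hα : ∀ k ∈ s, α k ∈ Set.Icc (-P.L) P.L) (h0 : ∑ k ∈ s, p k * α k = 0) :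
    ∑ k ∈ s, p k * U (τ + T x z (α k)) ≤ U τ := by
  set q : MeasureTheory.Measure ℝ :=
    ∑ k ∈ s, ENNReal.ofReal (p k) • MeasureTheory.Measure.dirac (α k) with hq
  have hint : ∀ f : ℝ → ℝ, ∀ k ∈ s, MeasureTheory.Integrable f
      (ENNReal.ofReal (p k) • MeasureTheory.Measure.dirac (α k)) := fun f k _ =>
    (MeasureTheory.integrable_dirac (by simp)).smul_measure ENNReal.ofReal_ne_top
  have hval : ∀ f : ℝ → ℝ, ∫ a, f a ∂q = ∑ k ∈ s, p k * f (α k) := by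
    intro f
    rw [hq, MeasureTheory.integral_finsetSum_measure (hint f)]
    refine Finset.sum_congr rfl fun k hk => ?_
    rw [MeasureTheory.integral_smul_measure, MeasureTheory.integral_dirac,
      ENNReal.toReal_ofReal (hp k hk), smul_eq_mul]
  have hprob : MeasureTheory.IsProbabilityMeasure q := by
    refine ⟨?_⟩
    rw [hq, MeasureTheory.Measure.finsetSum_apply]
    simp only [MeasureTheory.Measure.smul_apply, MeasureTheory.measure_univ, smul_eq_mul, mul_one]
    rw [← ENNReal.ofReal_sum_of_nonneg hp, hp1, ENNReal.ofReal_one]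
  have hsupp : ∀ᵐ a ∂q, a ∈ Set.Icc (-P.L) P.L := by
    rw [MeasureTheory.ae_iff, hq, MeasureTheory.Measure.finsetSum_apply]
    refine Finset.sum_eq_zero fun k hk => ?_
    rw [MeasureTheory.Measure.smul_apply, MeasureTheory.Measure.dirac_apply,
      Set.indicator_of_notMem (by simpa using hα k hk), smul_zero]
  have := hU τ x z hz q hprob hsupp (by rw [hval fun a => a]; exact h0)
    (by rw [hq]; exact MeasureTheory.integrable_finsetSum_measure.2 (hint _))
  rwa [hval fun a => U (τ + T x z a)] at this

/-- A convex function lies below its chord over `[-L, L]`. The chord is affine, so its mean under a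
mean-zero law is its value at `0`, the average of the two endpoint values. -/
theorem RademacherConcave.sum_le {P : OnlineProblem X} {T : X → ℝ → ℝ → S} {U : S → ℝ}
    (hU : P.RademacherConcave T U) (τ : S) (x : X) {z : ℝ} (hz : z ∈ P.Y) {κ : Type*}
    (s : Finset κ) (p α : κ → ℝ) (hp : ∀ k ∈ s, 0 ≤ p k) (hp1 : ∑ k ∈ s, p k = 1)
    (hα : ∀ k ∈ s, α k ∈ Set.Icc (-P.L) P.L) (h0 : ∑ k ∈ s, p k * α k = 0) :
    ∑ k ∈ s, p k * U (τ + T x z (α k)) ≤ U τ := by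
  obtain ⟨hc, hm⟩ := hU τ x z hz
  have hs : s.Nonempty := by
    rw [Finset.nonempty_iff_ne_empty]; rintro rfl; simp at hp1
  obtain ⟨k₀, hk₀⟩ := hs
  have hL : 0 ≤ P.L := by have := hα k₀ hk₀; have := this.1.trans this.2; linarith
  -- For `L = 0` the chord degenerates, but then all `α k` vanish.
  rcases hL.eq_or_lt with hL | hL
  · rw [← hL] at hm hα
    have hz : ∀ k ∈ s, α k = 0 := fun k hk => by
      have := hα k hk; rw [neg_zero, Set.Icc_self] at this; exact this
    calc ∑ k ∈ s, p k * U (τ + T x z (α k)) = ∑ k ∈ s, p k * U (τ + T x z 0) :=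
          Finset.sum_congr rfl fun k hk => by rw [hz k hk]
      _ = U (τ + T x z 0) := by rw [← Finset.sum_mul, hp1, one_mul]
      _ ≤ U τ := by rw [neg_zero] at hm; linarith
  · set a := U (τ + T x z P.L)
    set b := U (τ + T x z (-P.L))
    have key : ∀ k ∈ s, U (τ + T x z (α k)) ≤ (a + b) / 2 + α k * ((a - b) / (2 * P.L)) := by
      intro k hk
      have hk' := hα k hk
      have h2L : 0 < 2 * P.L := by linarith
      have := hc.2 (Set.right_mem_Icc.2 (by linarith)) (Set.left_mem_Icc.2 (by linarith))
        (show 0 ≤ (P.L + α k) / (2 * P.L) from div_nonneg (by linarith [hk'.1]) h2L.le)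
        (show 0 ≤ (P.L - α k) / (2 * P.L) from div_nonneg (by linarith [hk'.2]) h2L.le)
        (by field_simp; ring)
      simp only [smul_eq_mul] at this
      have e : (P.L + α k) / (2 * P.L) * P.L + (P.L - α k) / (2 * P.L) * -P.L = α k := by
        field_simp; ring
      rw [e] at this
      refine this.trans (le_of_eq ?_)
      change (P.L + α k) / (2 * P.L) * a + (P.L - α k) / (2 * P.L) * b = _
      field_simp
      ring
    calc ∑ k ∈ s, p k * U (τ + T x z (α k))
        ≤ ∑ k ∈ s, p k * ((a + b) / 2 + α k * ((a - b) / (2 * P.L))) :=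
          Finset.sum_le_sum fun k hk => mul_le_mul_of_nonneg_left (key k hk) (hp k hk)
      _ = (∑ k ∈ s, p k) * ((a + b) / 2) + (∑ k ∈ s, p k * α k) * ((a - b) / (2 * P.L)) := by
          rw [Finset.sum_mul, Finset.sum_mul, ← Finset.sum_add_distrib]
          exact Finset.sum_congr rfl fun k _ => by ring
      _ ≤ U τ := by rw [hp1, h0]; linarith

theorem IsBurkholder.sum_le {P : OnlineProblem X} {T : X → ℝ → ℝ → S} {V U : S → ℝ}
    (hU : P.IsBurkholder T V U) (τ : S) (x : X) {z : ℝ} (hz : z ∈ P.Y) {κ : Type*}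
    (s : Finset κ) (p α : κ → ℝ) (hp : ∀ k ∈ s, 0 ≤ p k) (hp1 : ∑ k ∈ s, p k = 1)
    (hα : ∀ k ∈ s, α k ∈ Set.Icc (-P.L) P.L) (h0 : ∑ k ∈ s, p k * α k = 0) :
    ∑ k ∈ s, p k * U (τ + T x z (α k)) ≤ U τ := by
  rcases hU.2.2 with h | h
  · exact h.sum_le τ x hz s p α hp hp1 hα h0
  · exact h.sum_le τ x hz s p α hp hp1 hα h0

/-- For every finitely supported distribution of outcomes there is a prediction at which the
chosen subderivatives have mean zero. -/
theorem exists_sum_dloss_eq_zero (P : OnlineProblem X) (s : Finset ℝ) (p : ℝ → ℝ)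
    (hs : (s : Set ℝ) ⊆ P.Y) (hp : ∀ y ∈ s, 0 < p y) (hp1 : ∑ y ∈ s, p y = 1) :
    ∃ z ∈ P.Y, ∑ y ∈ s, p y * P.dloss z y = 0 := by
  obtain ⟨z, hz, hmin, hd | h0⟩ := P.exists_minimizer s p hs hp hp1
  · refine ⟨z, hz, ?_⟩
    have h1 : HasDerivAt (fun w => ∑ y ∈ s, p y * P.loss w y) (∑ y ∈ s, p y * P.dloss z y) z := by
      refine HasDerivAt.fun_sum fun y hy => ?_
      rw [P.dloss_eq_deriv z hz y (hs hy) (hd y hy)]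
      exact (hd y hy).hasDerivAt.const_mul _
    -- The minimizer is global over `ℝ`, so the derivative vanishes even if `z` is an endpoint of
    -- `[-B, B]`.
    exact IsLocalMin.hasDerivAt_eq_zero (Filter.Eventually.of_forall hmin) h1
  · exact ⟨z, hz, h0⟩

/-- For every multiset of outcomes there is a prediction after which `U` has not increased on
average. -/
theorem IsBurkholder.exists_sum_next_le {P : OnlineProblem X} {T : X → ℝ → ℝ → S} {V U : S → ℝ}
    (hU : P.IsBurkholder T V U) (ζ : S) (x : X) (ys : Multiset ℝ) (h0 : ys ≠ 0)
    (hys : ∀ y ∈ ys, y ∈ P.Y) :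
    ∃ z ∈ P.Y, (ys.map (P.next T U ζ x z)).sum ≤ U ζ * ys.card := by
  classical
  have hc : (0 : ℝ) < ys.card := by exact_mod_cast Multiset.card_pos.2 h0
  -- The empirical distribution of `ys`, with multiplicities as weights.
  have hp1 : ∑ y ∈ ys.toFinset, (ys.count y : ℝ) / ys.card = 1 := by
    rw [← Finset.sum_div, ← Nat.cast_sum, Multiset.toFinset_sum_count_eq, div_self hc.ne']
  obtain ⟨z, hz, hd⟩ := P.exists_sum_dloss_eq_zero ys.toFinset (fun y => (ys.count y : ℝ) / ys.card)
    (fun y hy => hys y (by simpa using hy))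
    (fun y hy => div_pos (by exact_mod_cast Multiset.count_pos.2 (by simpa using hy)) hc) hp1
  refine ⟨z, hz, ?_⟩
  have := hU.sum_le ζ x hz ys.toFinset (fun y => (ys.count y : ℝ) / ys.card) (P.dloss z)
    (fun y _ => by positivity) hp1
    (fun y hy => P.dloss_mem z hz y (hys y (by simpa using hy))) hd
  rw [← div_le_iff₀ hc]
  refine le_trans (le_of_eq ?_) this
  rw [Finset.sum_multiset_map_count, Finset.sum_div]
  exact Finset.sum_congr rfl fun y _ => by rw [nsmul_eq_mul, next]; ring

end OnlineProblem

/-! ### The control points. -/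

theorem gridSize_pos {B ε : ℝ} (hB : 0 < B) (hε : 0 < ε) : 0 < gridSize B ε :=
  Nat.ceil_pos.2 (by positivity)

theorem gridPoint_mem {B ε : ℝ} (hB : 0 < B) (hε : 0 < ε) (i : Fin (gridSize B ε)) :
    gridPoint B ε i ∈ Set.Icc (-B) B := by
  refine ⟨le_min (by linarith) ?_, min_le_left _ _⟩
  have : 0 ≤ ε * ((i : ℝ) + 1) := by positivity
  linarith

/-- The control points form an `ε`-net. -/
theorem exists_abs_sub_gridPoint_le {B ε : ℝ} (hB : 0 < B) (hε : 0 < ε) {z : ℝ}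
    (hz : z ∈ Set.Icc (-B) B) : ∃ i, |z - gridPoint B ε i| ≤ ε := by
  have hN := gridSize_pos hB hε
  have hfl : (⌊(z + B) / ε⌋₊ : ℝ) ≤ (z + B) / ε :=
    Nat.floor_le (div_nonneg (by linarith [hz.1]) hε.le)
  have hfl' : (z + B) / ε < ⌊(z + B) / ε⌋₊ + 1 := Nat.lt_floor_add_one _
  rw [le_div_iff₀ hε] at hfl
  rw [div_lt_iff₀ hε] at hfl'
  by_cases hi : ⌊(z + B) / ε⌋₊ < gridSize B ε
  · refine ⟨⟨_, hi⟩, ?_⟩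
    rw [gridPoint, abs_le]
    constructor
    · have := min_le_right B (-B + ε * ((⌊(z + B) / ε⌋₊ : ℝ) + 1))
      dsimp only
      linarith
    · have : z ≤ min B (-B + ε * ((⌊(z + B) / ε⌋₊ : ℝ) + 1)) := le_min hz.2 (by linarith)
      dsimp only
      linarith
  -- In general `z` is rounded up to the right end of its cell. The index leaves the range only for
  -- `z = B`, which is the last control point.
  · refine ⟨⟨gridSize B ε - 1, by omega⟩, ?_⟩
    have h1 : 2 * B ≤ ε * gridSize B ε := by
      have := Nat.le_ceil (2 * B / ε)
      rw [div_le_iff₀ hε] at this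
      rw [mul_comm ε]; exact this
    have h2 : (gridSize B ε : ℝ) ≤ ⌊(z + B) / ε⌋₊ := by exact_mod_cast not_lt.1 hi
    have h3 : ε * gridSize B ε ≤ ε * ⌊(z + B) / ε⌋₊ := mul_le_mul_of_nonneg_left h2 hε.le
    have h4 : z = B := le_antisymm hz.2 (by linarith)
    have h5 : ((gridSize B ε - 1 : ℕ) : ℝ) = gridSize B ε - 1 := by
      rw [Nat.cast_sub hN, Nat.cast_one]
    rw [gridPoint]
    dsimp only
    rw [h5, sub_add_cancel, min_eq_left (by linarith), h4, sub_self, abs_zero]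
    exact hε.le

/-- `gridObjective` is a real supremum, with default value zero for unbounded sets; boundedness
makes it a genuine upper bound. -/
theorem bddAbove_gridObjective {B ε H : ℝ} {F : ℝ → ℝ → ℝ} (hB : 0 < B) (hε : 0 < ε)
    (hF : ∀ y ∈ Set.Icc (-B) B, ∀ z ∈ Set.Icc (-B) B, |F z y| ≤ H)
    {μ : Fin (gridSize B ε) → ℝ} (hμ : μ ∈ stdSimplex ℝ (Fin (gridSize B ε))) :
    BddAbove (Set.range fun y : Set.Icc (-B) B => ∑ i, μ i * F (gridPoint B ε i) y) := by
  refine ⟨H, ?_⟩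
  rintro _ ⟨y, rfl⟩
  exact (abs_le.1 (abs_weighted_sum_le hμ fun i => hF y y.2 _ (gridPoint_mem hB hε i))).2

/-! ### One round of the discretized game, and induction over the rounds. -/

namespace OnlineProblem

variable {X : Type u} {S : Type v} [AddCommGroup S]

/-- Value of a round of the discretized game. -/
theorem IsBurkholder.sum_next_le {P : OnlineProblem X} {T : X → ℝ → ℝ → S} {V U : S → ℝ}
    (hU : P.IsBurkholder T V U) {ζ : S} {x : X} {K H ε₁ ε₂ : ℝ} (hε : 0 < ε₁)
    (hK : ∀ y ∈ P.Y, ∀ a ∈ P.Y, ∀ b ∈ P.Y,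
      |P.next T U ζ x a y - P.next T U ζ x b y| ≤ K * |a - b|)
    (hH : ∀ y ∈ P.Y, ∀ a ∈ P.Y, |P.next T U ζ x a y| ≤ H)
    {μ : Fin (gridSize P.B ε₁) → ℝ} (hμ : IsApproxSolution P.B ε₁ ε₂ (P.next T U ζ x) μ)
    {y : ℝ} (hy : y ∈ P.Y) :
    ∑ i, μ i * P.next T U ζ x (gridPoint P.B ε₁ i) y ≤ U ζ + ε₁ * K + ε₂ := by
  have hB := P.B_pos
  have hK0 : 0 ≤ K := by
    have := (abs_nonneg _).trans (hK y hy P.B (Set.right_mem_Icc.2 (by linarith)) (-P.B)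
      (Set.left_mem_Icc.2 (by linarith)))
    exact nonneg_of_mul_nonneg_left this (abs_pos.2 (by linarith))
  have : Nonempty (Set.Icc (-P.B) P.B) := ⟨⟨y, hy⟩⟩
  refine le_of_forall_pos_le_add fun δ hδ => ?_
  obtain ⟨ν, hν, hν'⟩ := exists_mem_stdSimplex_forall_le (gridSize_pos hB hε)
    (F := fun i (y : Set.Icc (-P.B) P.B) => P.next T U ζ x (gridPoint P.B ε₁ i) y)
    (H := H) (c := U ζ + ε₁ * K) (fun i y => hH y y.2 _ (gridPoint_mem hB hε i)) hδ (by
      -- The good prediction `z` for the law of `ys` is moved to a control point at distance at most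
      -- `ε₁`, which costs `ε₁ * K` per outcome.
      intro ys h0
      obtain ⟨z, hz, hzs⟩ := hU.exists_sum_next_le ζ x (ys.map Subtype.val) (by simpa using h0)
        (by simp only [Multiset.mem_map]; rintro _ ⟨y, -, rfl⟩; exact y.2)
      obtain ⟨i, hi⟩ := exists_abs_sub_gridPoint_le hB hε hz
      refine ⟨i, ?_⟩
      rw [Multiset.map_map, Multiset.card_map] at hzs
      calc (ys.map fun y : Set.Icc (-P.B) P.B => P.next T U ζ x (gridPoint P.B ε₁ i) y).sum
          ≤ (ys.map fun y : Set.Icc (-P.B) P.B => P.next T U ζ x z y + ε₁ * K).sum := by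
            refine Multiset.sum_map_le_sum_map _ _ fun y _ => ?_
            have h1 := hK y y.2 z hz _ (gridPoint_mem hB hε i)
            have h2 : K * |z - gridPoint P.B ε₁ i| ≤ K * ε₁ := mul_le_mul_of_nonneg_left hi hK0
            have h3 := (abs_le.1 h1).1
            linarith
        _ ≤ _ := by
            rw [Multiset.sum_map_add, Multiset.map_const', Multiset.sum_replicate, nsmul_eq_mul]
            simp only [Function.comp_def] at hzs
            linarith)
  have h1 := le_ciSup (bddAbove_gridObjective hB hε hH hμ.1) ⟨y, hy⟩
  have h2 := hμ.2 ν hν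
  have h3 : gridObjective P.B ε₁ (P.next T U ζ x) ν ≤ U ζ + ε₁ * K + δ := ciSup_le hν'
  change _ ≤ gridObjective P.B ε₁ (P.next T U ζ x) μ at h1
  dsimp only at h1
  linarith

theorem stat_append_singleton (P : OnlineProblem X) (T : X → ℝ → ℝ → S) (h : Transcript X)
    (x : X) (z y : ℝ) : P.stat T (h ++ [(x, z, y)]) = P.stat T h + T x z (P.dloss z y) := by
  simp [stat]

theorem Valid.append_singleton {P : OnlineProblem X} {h : Transcript X} (hh : P.Valid h) {x : X}
    {z y : ℝ} (hz : z ∈ P.Y) (hy : y ∈ P.Y) : P.Valid (h ++ [(x, z, y)]) := by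
  intro e he
  rcases List.mem_append.1 he with he | he
  · exact hh e he
  · rw [List.mem_singleton.1 he]; exact ⟨hz, hy⟩

/-- The expected final value of the loss minus the benchmark is at most the value of `U` on the
transcript so far, up to the errors of the remaining rounds. -/
theorem expectation_sub_phi_le {P : OnlineProblem X} {T : X → ℝ → ℝ → S} {V U : S → ℝ}
    {K H : ℕ → ℝ} {ε₁ ε₂ : ℝ} {σ : GridStrategy X (gridSize P.B ε₁)}
    (hV : P.IsSufficientPair T V) (hU : P.IsBurkholder T V U) (hKH : P.LipschitzBounded T U K H)
    (hε : 0 < ε₁) (hσ : P.IsDiscretizedBurkholder T U ε₁ ε₂ σ) (data : List (X × ℝ)) :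
    ∀ h : Transcript X, P.Valid h → h.length + data.length = P.n → (∀ e ∈ data, e.2 ∈ P.Y) →
      P.expectation ε₁ σ P.totalLoss h data - P.phi (h.map (fun e => (e.1, e.2.2)) ++ data) ≤
        U (P.stat T h) + ∑ t ∈ Finset.Ioc h.length P.n, (ε₁ * K t + ε₂) := by
  induction data with
  | nil =>
    intro h hh hl _
    rw [List.length_nil, add_zero] at hl
    rw [expectation, List.append_nil, hl, Finset.Ioc_self, Finset.sum_empty, add_zero]
    exact (hV h hl hh).trans (hU.2.1 _)
  | cons e rest ih =>
    intro h hh hl hd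
    rw [List.length_cons] at hl
    have hlt : h.length < P.n := by omega
    have he : e.2 ∈ P.Y := hd e List.mem_cons_self
    have hs := hσ h hlt hh e.1
    set c := ∑ t ∈ Finset.Ioc (h.length + 1) P.n, (ε₁ * K t + ε₂) with hc
    -- `phi` does not depend on the predictions, so `Φ` is the same in all branches of the random
    -- draw.
    set Φ := P.phi (h.map (fun e => (e.1, e.2.2)) ++ e :: rest) with hΦ
    have hstep : ∀ i,
        P.expectation ε₁ σ P.totalLoss (h ++ [(e.1, gridPoint P.B ε₁ i, e.2)]) rest ≤
          P.next T U (P.stat T h) e.1 (gridPoint P.B ε₁ i) e.2 + (c + Φ) := by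
      intro i
      have := ih (h ++ [(e.1, gridPoint P.B ε₁ i, e.2)])
        (hh.append_singleton (gridPoint_mem P.B_pos hε i) he) (by simp; omega)
        (fun e' he' => hd e' (List.mem_cons_of_mem _ he'))
      rw [stat_append_singleton, List.length_append, List.length_singleton, List.map_append,
        List.append_assoc] at this
      change _ - Φ ≤ P.next T U (P.stat T h) e.1 (gridPoint P.B ε₁ i) e.2 + c at this
      linarith
    have hr := hKH (h.length + 1) (Finset.mem_Icc.2 ⟨by omega, by omega⟩) h rfl hh e.1
    have hround := hU.sum_next_le hε (fun y hy => (hr y hy).1) (fun y hy => (hr y hy).2) hs he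
    rw [expectation, ← Finset.insert_Ioc_add_one_left_eq_Ioc hlt, Finset.sum_insert (by simp)]
    calc ∑ i, σ h e.1 i *
          P.expectation ε₁ σ P.totalLoss (h ++ [(e.1, gridPoint P.B ε₁ i, e.2)]) rest - Φ
        ≤ ∑ i, σ h e.1 i *
          (P.next T U (P.stat T h) e.1 (gridPoint P.B ε₁ i) e.2 + (c + Φ)) - Φ := by
          gcongr with i
          · exact hs.1.1 i
          · exact hstep i
      _ = ∑ i, σ h e.1 i * P.next T U (P.stat T h) e.1 (gridPoint P.B ε₁ i) e.2 + c := by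
          simp only [mul_add, Finset.sum_add_distrib]
          rw [← Finset.sum_mul, ← Finset.sum_mul, hs.1.2]; ring
      _ ≤ U (P.stat T h) + (ε₁ * K (h.length + 1) + ε₂ + c) := by linarith

theorem regretAtMost {P : OnlineProblem X} {T : X → ℝ → ℝ → S} {V U : S → ℝ}
    {K H : ℕ → ℝ} {ε₁ ε₂ : ℝ} {σ : GridStrategy X (gridSize P.B ε₁)}
    (hV : P.IsSufficientPair T V) (hU : P.IsBurkholder T V U) (hKH : P.LipschitzBounded T U K H)
    (hε : 0 < ε₁) (hσ : P.IsDiscretizedBurkholder T U ε₁ ε₂ σ) :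
    P.RegretAtMost ε₁ σ (ε₁ * ∑ t ∈ Finset.Icc 1 P.n, K t + ε₂ * P.n) := by
  intro data hl hd
  have h := expectation_sub_phi_le hV hU hKH hε hσ data [] (by simp [Valid]) (by simpa using hl) hd
  have h0 : U (P.stat T []) ≤ 0 := by simpa [stat] using hU.1
  have hs : ∑ t ∈ Finset.Ioc 0 P.n, (ε₁ * K t + ε₂) =
      ε₁ * ∑ t ∈ Finset.Icc 1 P.n, K t + ε₂ * P.n := by
    have : Finset.Ioc 0 P.n = Finset.Icc 1 P.n := rfl
    rw [this, Finset.sum_add_distrib, ← Finset.mul_sum, Finset.sum_const, Nat.card_Icc, nsmul_eq_mul]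
    simp [mul_comm]
  simp only [List.map_nil, List.nil_append, List.length_nil] at h
  rw [hs] at h
  linarith

end OnlineProblem

/-! ### Total correctness of programs with time bounds -/

/-- The program `c`, started in `s`, halts within `k` steps in a state that satisfies `Q`. -/
def Ends (F : ℝ → ℝ → ℝ) (c : Program) (s : MachineState) (k : ℕ) (Q : MachineState → Prop) :
    Prop :=
  ∃ k' ≤ k, ∃ s', Exec F c s k' s' ∧ Q s'

namespace Ends

variable {F : ℝ → ℝ → ℝ} {s : MachineState} {k k₁ k₂ : ℕ} {Q Q' : MachineState → Prop}
  {c c₁ c₂ : Program}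

theorem mono (h : Ends F c s k₁ Q) (hk : k₁ ≤ k) (hQ : ∀ s', Q s' → Q' s') : Ends F c s k Q' := by
  obtain ⟨k', hk', s', he, hs⟩ := h
  exact ⟨k', hk'.trans hk, s', he, hQ s' hs⟩

theorem skip (hk : 1 ≤ k) (hQ : Q s) : Ends F .skip s k Q := ⟨1, hk, s, .skip s, hQ⟩

theorem setReg {r : ℕ} {e : IdxExpr} (hk : e.cost + 1 ≤ k)
    (hQ : Q { s with regs := Function.update s.regs r (e.eval s) }) :
    Ends F (.setReg r e) s k Q :=
  ⟨_, hk, _, .setReg r e s, hQ⟩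

theorem store {a : IdxExpr} {e : RealExpr} (hk : a.cost + e.cost + 1 ≤ k)
    (hQ : Q { s with mem := Function.update s.mem (a.eval s) (e.eval F s) }) :
    Ends F (.store a e) s k Q :=
  ⟨_, hk, _, .store a e s, hQ⟩

theorem seq (h : Ends F c₁ s k₁ fun s₁ => Ends F c₂ s₁ k₂ Q) (hk : k₁ + k₂ ≤ k) :
    Ends F (.seq c₁ c₂) s k Q := by
  obtain ⟨k₁', hk₁, s₁, he₁, k₂', hk₂, s₂, he₂, hs⟩ := h
  exact ⟨k₁' + k₂', (Nat.add_le_add hk₁ hk₂).trans hk, s₂, .seq he₁ he₂, hs⟩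

theorem ite {b : TestExpr} (h₁ : b.holds F s → Ends F c₁ s k₁ Q)
    (h₂ : ¬ b.holds F s → Ends F c₂ s k₁ Q) (hk : b.cost + k₁ + 1 ≤ k) :
    Ends F (.ite b c₁ c₂) s k Q := by
  by_cases hb : b.holds F s
  · obtain ⟨k', hk', s', he, hs⟩ := h₁ hb
    exact ⟨_, by omega, s', .iteTrue hb he, hs⟩
  · obtain ⟨k', hk', s', he, hs⟩ := h₂ hb
    exact ⟨_, by omega, s', .iteFalse hb he, hs⟩

/-- A loop that is passed through exactly `n` times. -/
theorem loop {b : TestExpr} (n : ℕ) (J : ℕ → MachineState → Prop)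
    (hstep : ∀ i < n, ∀ s, J i s → b.holds F s ∧ Ends F c s k₁ (J (i + 1)))
    (hend : ∀ s, J n s → ¬ b.holds F s) (h0 : J 0 s)
    (hk : n * (b.cost + k₁ + 1) + (b.cost + 1) ≤ k) : Ends F (.loop b c) s k (J n) := by
  -- Induction on the number `m` of remaining passes; the last summand pays for the failing test at
  -- the end.
  have key : ∀ m ≤ n, ∀ s, J (n - m) s →
      Ends F (.loop b c) s (m * (b.cost + k₁ + 1) + (b.cost + 1)) (J n) := by
    intro m
    induction m with
    | zero => exact fun _ s hs => ⟨_, by omega, s, .loopFalse (hend s hs), hs⟩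
    | succ m ih =>
      intro hm s hs
      obtain ⟨hb, k', hk', s', he, hs'⟩ := hstep (n - (m + 1)) (by omega) s hs
      rw [show n - (m + 1) + 1 = n - m by omega] at hs'
      obtain ⟨k'', hk'', s'', he', hs''⟩ := ih (by omega) s' hs'
      refine ⟨_, ?_, s'', .loopTrue hb he he', hs''⟩
      rw [Nat.succ_mul]
      omega
  exact (key n le_rfl s (by rwa [Nat.sub_self])).mono hk fun _ h => h

end Ends

/-- Increment of a register. -/
def Program.incr (r : ℕ) : Program := .setReg r (.add (.reg r) (.const 1))

/-- Execution of `c` with the register `r` running through `0, …, bound - 1`. -/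
def Program.forLoop (r : ℕ) (bound : IdxExpr) (c : Program) : Program :=
  .seq (.setReg r (.const 0)) (.loop (.idxLt (.reg r) bound) (.seq c (.incr r)))

theorem Ends.forLoop {F : ℝ → ℝ → ℝ} {s : MachineState} {k k₁ : ℕ} {c : Program} {r : ℕ}
    {bound : IdxExpr} (n : ℕ) (J : ℕ → MachineState → Prop)
    (hJ : ∀ i s, J i s → s.regs r = i ∧ bound.eval s = n)
    (hstep : ∀ i < n, ∀ s, J i s →
      Ends F c s k₁ fun s' => J (i + 1) { s' with regs := Function.update s'.regs r (s'.regs r + 1) })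
    (h0 : J 0 { s with regs := Function.update s.regs r 0 })
    (hk : (n + 1) * (bound.cost + k₁ + 7) ≤ k) : Ends F (.forLoop r bound c) s k (J n) := by
  refine Ends.seq (k₁ := 2) (k₂ := n * (bound.cost + k₁ + 7) + (bound.cost + 3)) ?_ ?_
  · refine Ends.setReg (by simp [IdxExpr.cost]) (Ends.loop (k₁ := k₁ + 4) n J ?_ ?_ h0 ?_)
    · intro i hi s hs
      obtain ⟨h1, h2⟩ := hJ i s hs
      refine ⟨by simpa only [TestExpr.holds, IdxExpr.eval, h1, h2] using hi,
        Ends.seq ((hstep i hi s hs).mono le_rfl fun s' hs' =>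
          Ends.setReg (k := 4) (by simp [IdxExpr.cost]) (by simpa only [IdxExpr.eval] using hs')) le_rfl⟩
    · intro s hs
      obtain ⟨h1, h2⟩ := hJ n s hs
      simp only [TestExpr.holds, IdxExpr.eval, h1, h2, lt_irrefl, not_false_iff]
    · simp only [TestExpr.cost, IdxExpr.cost]
      -- Per pass: `bound.cost + 2` for the test, `k₁` for the body, `4` for the increment and `1`
      -- for the loop.
      rw [show 1 + bound.cost + 1 + (k₁ + 4) + 1 = bound.cost + k₁ + 7 by ring]
      omega
  · rw [Nat.succ_mul] at hk; omega

/-! ### The program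

Register `0` holds the number `N` of control points, `1` and `2` are loop counters, `3` is the
round of regret matching, and `4` the best response. Cells `5`, `6`, `7` of the array are scratch
space. From cell `8` on, there are four arrays of length `N`: the sum of the mixed actions, the
regrets, the positive parts of the regrets, and the control points. -/

namespace Program

def actionIdx : IdxExpr := .add (.const 8) (.reg 1)
def regretIdx : IdxExpr := .add (.const 8) (.add (.reg 0) (.reg 1))
def weightIdx : IdxExpr := .add (.const 8) (.add (.reg 0) (.add (.reg 0) (.reg 1)))
def pointIdx : IdxExpr := .add (.const 8) (.add (.reg 0) (.add (.reg 0) (.add (.reg 0) (.reg 1))))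

/-- The outcome whose number is in register `r`. -/
def outcomeExpr (r : ℕ) : RealExpr :=
  .sub (.div (.mul (.load (.const 0)) (.ofIdx (.reg r))) (.ofIdx (.reg 0))) (.load (.const 0))

/-- The machine has no rounding operation, so the ceiling of `2B / ε₁` is found by counting. Cells
`0` to `4` hold the inputs `B`, `K`, `H`, `ε₁`, `ε₂`. -/
def countPoints : Program :=
  .loop (.realLt (.ofIdx (.reg 0))
    (.div (.add (.load (.const 0)) (.load (.const 0))) (.load (.const 3)))) (.incr 0)

def writePoints : Program :=
  .forLoop 1 (.reg 0) (.seq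
    (.store pointIdx
      (.sub (.mul (.load (.const 3)) (.ofIdx (.add (.reg 1) (.const 1)))) (.load (.const 0))))
    (.ite (.realLt (.load (.const 0)) (.load pointIdx)) (.store pointIdx (.load (.const 0))) .skip))

/-- The weights stay unnormalized. Cell `5` accumulates their sum, by which `updateRegrets` divides.
-/
def writePositiveParts : Program :=
  .seq (.store (.const 5) (.ofIdx (.const 0))) (.forLoop 1 (.reg 0)
    (.ite (.realLt (.ofIdx (.const 0)) (.load regretIdx))
      (.seq (.store weightIdx (.load regretIdx))
        (.store (.const 5) (.add (.load (.const 5)) (.load regretIdx))))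
      (.store weightIdx (.ofIdx (.const 0)))))

/-- If all weights are zero, then the weight of the first action is changed to one. -/
def fixWeights : Program :=
  .ite (.realLt (.ofIdx (.const 0)) (.load (.const 5))) .skip
    (.seq (.store (.add (.const 8) (.add (.reg 0) (.reg 0))) (.ofIdx (.const 1)))
      (.store (.const 5) (.ofIdx (.const 1))))

/-- Weighted sum of the oracle values for the outcome whose number is in register `2`. -/
def evalOutcome : Program :=
  .seq (.store (.const 6) (.ofIdx (.const 0))) (.forLoop 1 (.reg 0)
    (.store (.const 6) (.add (.load (.const 6))
      (.mul (.load weightIdx) (.oracle (.load pointIdx) (outcomeExpr 2))))))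

/-- Unnormalized weights suffice, since a positive factor does not change the maximizing outcome.
Cell `7` keeps the largest payoff found. -/
def bestResponse : Program :=
  .seq (.setReg 4 (.const 0)) (.seq (.setReg 2 (.const 0)) (.seq evalOutcome
    (.seq (.store (.const 7) (.load (.const 6)))
      (.forLoop 2 (.add (.const 1) (.add (.reg 0) (.reg 0))) (.seq evalOutcome
        (.ite (.realLt (.load (.const 7)) (.load (.const 6)))
          (.seq (.store (.const 7) (.load (.const 6))) (.setReg 4 (.reg 2))) .skip))))))

def updateRegrets : Program :=
  .forLoop 1 (.reg 0) (.seq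
    (.store actionIdx (.add (.load actionIdx) (.div (.load weightIdx) (.load (.const 5)))))
    (.store regretIdx (.add (.load regretIdx) (.sub (.div (.load (.const 7)) (.load (.const 5)))
      (.oracle (.load pointIdx) (outcomeExpr 4))))))

def matchingRound : Program :=
  .seq writePositiveParts (.seq fixWeights (.seq bestResponse (.seq updateRegrets (.incr 3))))

def matching : Program :=
  .loop (.realLt (.mul (.ofIdx (.reg 3)) (.mul (.load (.const 4)) (.load (.const 4))))
      (.mul (.add (.mul (.ofIdx (.const 16)) (.mul (.load (.const 2)) (.load (.const 2))))
        (.ofIdx (.const 1))) (.ofIdx (.reg 0))))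
    matchingRound

/-- The output overwrites the inputs and possibly the array being read. This is harmless: cell `i`
is computed from cell `8 + i`, which has not been overwritten yet. -/
def writeAverage : Program :=
  .forLoop 1 (.reg 0) (.store (.reg 1) (.div (.load actionIdx) (.ofIdx (.reg 3))))

/-- Approximate solution of the finite convex program by regret matching. -/
def solver : Program := .seq countPoints (.seq writePoints (.seq matching writeAverage))

end Program

/-! ### Specifications of the subprograms with time bounds and frame conditions. -/

section Specifications

open Program

variable {F : ℝ → ℝ → ℝ} {s : MachineState}

theorem ends_countPoints {B ε : ℝ} (h0 : s.regs 0 = 0) (hB : s.mem 0 = B) (hε : s.mem 3 = ε) :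
    Ends F countPoints s (20 * (gridSize B ε + 1)) fun s' =>
      s'.mem = s.mem ∧ s'.regs = Function.update s.regs 0 (gridSize B ε) := by
  have hN : ∀ i : ℕ, (i : ℝ) < (B + B) / ε ↔ i < gridSize B ε := by
    intro i; rw [gridSize, ← two_mul, Nat.lt_ceil]
  refine Ends.loop (k₁ := 4) (gridSize B ε)
    (fun i s' => s'.mem = s.mem ∧ s'.regs = Function.update s.regs 0 i) ?_ ?_ ?_ ?_
  · rintro i hi s' ⟨hm, hr⟩
    refine ⟨?_, Ends.setReg (by decide) ⟨hm, ?_⟩⟩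
    · simpa [TestExpr.holds, RealExpr.eval, IdxExpr.eval, hm, hr, hB, hε, hN] using hi
    · simp [IdxExpr.eval, hr]
  · rintro s' ⟨hm, hr⟩
    simp [TestExpr.holds, RealExpr.eval, IdxExpr.eval, hm, hr, hB, hε, hN]
  · exact ⟨rfl, by simpa only [h0] using (Function.update_eq_self 0 s.regs).symm⟩
  · simp only [TestExpr.cost, RealExpr.cost, IdxExpr.cost]; omega

theorem ends_writePoints {B ε : ℝ} {N : ℕ} (h0 : s.regs 0 = N) (hB : s.mem 0 = B)
    (hε : s.mem 3 = ε) :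
    Ends F writePoints s (100 * (N + 1)) fun s' =>
      (∀ r ≠ 1, s'.regs r = s.regs r) ∧
      (∀ a < 8 + (N + (N + N)), s'.mem a = s.mem a) ∧
      ∀ i < N, s'.mem (8 + (N + (N + (N + i)))) = min B (-B + ε * ((i : ℝ) + 1)) := by
  refine (Ends.forLoop (k₁ := 80) N (fun i s' => s'.regs 1 = i ∧
      (∀ r ≠ 1, s'.regs r = s.regs r) ∧
      (∀ a < 8 + (N + (N + N)), s'.mem a = s.mem a) ∧
      ∀ j < i, s'.mem (8 + (N + (N + (N + j)))) = min B (-B + ε * ((j : ℝ) + 1)))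
      ?_ ?_ ?_ ?_).mono le_rfl ?_
  · rintro i s' ⟨h1, hr, -⟩
    exact ⟨h1, by simp [IdxExpr.eval, hr, h0]⟩
  · rintro i hi s' ⟨h1, hr, hm, hz⟩
    have hr0 : s'.regs 0 = N := by rw [hr 0 (by decide), h0]
    have hm0 : s'.mem 0 = B := by rw [hm 0 (by omega), hB]
    have hm3 : s'.mem 3 = ε := by rw [hm 3 (by omega), hε]
    have hv : ε * ((i : ℝ) + 1) - B = -B + ε * ((i : ℝ) + 1) := by ring
    refine Ends.seq (k₁ := 40) (k₂ := 40) (Ends.store (by decide) (Ends.ite (k₁ := 20) ?_ ?_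
      (by decide))) le_rfl
    · intro hb
      simp only [TestExpr.holds, RealExpr.eval, IdxExpr.eval, pointIdx, hr0, h1, hm0, hm3,
        Function.update_self, Nat.cast_add, Nat.cast_one] at hb
      rw [Function.update_of_ne (by omega), hm0] at hb
      refine Ends.store (by decide) ?_
      simp only [RealExpr.eval, IdxExpr.eval, pointIdx, hr0, h1]
      refine ⟨by simp, fun r hr1 => ?_, fun a ha => ?_, fun j hj => ?_⟩
      · rw [Function.update_of_ne hr1, hr r hr1]
      · rw [Function.update_of_ne (by omega), Function.update_of_ne (by omega), hm a ha]
      · rcases Nat.lt_succ_iff_lt_or_eq.1 hj with hj | rfl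
        · rw [Function.update_of_ne (by omega), Function.update_of_ne (by omega), hz j hj]
        · rw [Function.update_self, Function.update_of_ne (by omega), hm0, min_eq_left]
          linarith
    · intro hb
      simp only [TestExpr.holds, RealExpr.eval, IdxExpr.eval, pointIdx, hr0, h1, hm0, hm3,
        Function.update_self, Nat.cast_add, Nat.cast_one] at hb
      rw [Function.update_of_ne (by omega), hm0] at hb
      refine Ends.skip (by decide) ?_
      simp only [RealExpr.eval, IdxExpr.eval, pointIdx, hr0, h1, hm0, hm3, Nat.cast_add,
        Nat.cast_one]
      refine ⟨by simp, fun r hr1 => ?_, fun a ha => ?_, fun j hj => ?_⟩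
      · rw [Function.update_of_ne hr1, hr r hr1]
      · rw [Function.update_of_ne (by omega), hm a ha]
      · rcases Nat.lt_succ_iff_lt_or_eq.1 hj with hj | rfl
        · rw [Function.update_of_ne (by omega), hz j hj]
        · rw [Function.update_self, min_eq_right (by linarith), hv]
  · exact ⟨by simp, fun r hr => by simp [hr], fun _ _ => rfl, fun j hj => absurd hj (by omega)⟩
  · simp only [IdxExpr.cost]; omega
  · rintro s' ⟨-, h⟩
    exact h

theorem ends_writePositiveParts {N : ℕ} (h0 : s.regs 0 = N) :
    Ends F writePositiveParts s (100 * (N + 1)) fun s' =>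
      (∀ r ≠ 1, s'.regs r = s.regs r) ∧
      (∀ a ≠ 5, (a < 8 + (N + N) ∨ 8 + (N + (N + N)) ≤ a) → s'.mem a = s.mem a) ∧
      s'.mem 5 = ∑ i ∈ Finset.range N, max (s.mem (8 + (N + i))) 0 ∧
      ∀ i < N, s'.mem (8 + (N + (N + i))) = max (s.mem (8 + (N + i))) 0 := by
  refine Ends.seq (k₁ := 10) (k₂ := 90 * (N + 1)) (Ends.store (by decide) ?_) (by omega)
  refine (Ends.forLoop (k₁ := 70) N (fun i s' => s'.regs 1 = i ∧
      (∀ r ≠ 1, s'.regs r = s.regs r) ∧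
      (∀ a ≠ 5, (a < 8 + (N + N) ∨ 8 + (N + (N + N)) ≤ a) → s'.mem a = s.mem a) ∧
      s'.mem 5 = ∑ j ∈ Finset.range i, max (s.mem (8 + (N + j))) 0 ∧
      ∀ j < i, s'.mem (8 + (N + (N + j))) = max (s.mem (8 + (N + j))) 0)
      ?_ ?_ ?_ ?_).mono le_rfl ?_
  · rintro i s' ⟨h1, hr, -⟩
    exact ⟨h1, by simp [IdxExpr.eval, hr, h0]⟩
  · rintro i hi s' ⟨h1, hr, hm, h5, hz⟩
    have hr0 : s'.regs 0 = N := by rw [hr 0 (by decide), h0]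
    have hri : s'.mem (8 + (N + i)) = s.mem (8 + (N + i)) := hm _ (by omega) (by omega)
    refine Ends.ite (k₁ := 50) ?_ ?_ (by decide)
    · intro hb
      simp only [TestExpr.holds, RealExpr.eval, IdxExpr.eval, regretIdx, hr0, h1, Nat.cast_zero,
        hri] at hb
      refine Ends.seq (k₁ := 25) (k₂ := 25) (Ends.store (by decide) (Ends.store (by decide) ?_))
        le_rfl
      simp only [RealExpr.eval, IdxExpr.eval, weightIdx, regretIdx, hr0, h1]
      refine ⟨by simp, fun r hr1 => ?_, fun a ha ha' => ?_, ?_, fun j hj => ?_⟩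
      · rw [Function.update_of_ne hr1, hr r hr1]
      · rw [Function.update_of_ne ha, Function.update_of_ne (by omega), hm a ha ha']
      · rw [Function.update_self, Function.update_of_ne (by omega),
          Function.update_of_ne (by omega), hri, h5, Finset.sum_range_succ, max_eq_left hb.le]
      · rw [Function.update_of_ne (by omega)]
        rcases Nat.lt_succ_iff_lt_or_eq.1 hj with hj | rfl
        · rw [Function.update_of_ne (by omega), hz j hj]
        · rw [Function.update_self, hri, max_eq_left hb.le]
    · intro hb
      simp only [TestExpr.holds, RealExpr.eval, IdxExpr.eval, regretIdx, hr0, h1, Nat.cast_zero,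
        hri, not_lt] at hb
      refine Ends.store (by decide) ?_
      simp only [RealExpr.eval, IdxExpr.eval, weightIdx, hr0, h1]
      refine ⟨by simp, fun r hr1 => ?_, fun a ha ha' => ?_, ?_, fun j hj => ?_⟩
      · rw [Function.update_of_ne hr1, hr r hr1]
      · rw [Function.update_of_ne (by omega), hm a ha ha']
      · rw [Function.update_of_ne (by omega), h5, Finset.sum_range_succ, max_eq_right hb, add_zero]
      · rcases Nat.lt_succ_iff_lt_or_eq.1 hj with hj | rfl
        · rw [Function.update_of_ne (by omega), hz j hj]
        · rw [Function.update_self, max_eq_right hb, Nat.cast_zero]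
  · refine ⟨by simp, fun r hr => by simp [hr], fun a ha _ => ?_, ?_, fun j hj => absurd hj (by omega)⟩
    · simp only [IdxExpr.eval]; rw [Function.update_of_ne ha]
    · simp [IdxExpr.eval, RealExpr.eval]
  · simp only [IdxExpr.cost]; omega
  · rintro s' ⟨-, h⟩
    exact h

/-- The factor `c` is `1` if some weight is positive and `0` otherwise; it preserves the
proportionality to the positive regrets that `RegretState.step` requires. -/
theorem ends_fixWeights {N : ℕ} (hN : 0 < N) (h0 : s.regs 0 = N)
    (h5 : s.mem 5 = ∑ i ∈ Finset.range N, s.mem (8 + (N + (N + i))))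
    (hw : ∀ i < N, 0 ≤ s.mem (8 + (N + (N + i)))) :
    Ends F fixWeights s 50 fun s' =>
      s'.regs = s.regs ∧
      (∀ a ≠ 5, (a < 8 + (N + N) ∨ 8 + (N + (N + N)) ≤ a) → s'.mem a = s.mem a) ∧
      0 < s'.mem 5 ∧ s'.mem 5 = ∑ i ∈ Finset.range N, s'.mem (8 + (N + (N + i))) ∧
      (∀ i < N, 0 ≤ s'.mem (8 + (N + (N + i)))) ∧
      ∃ c : ℝ, ∀ i < N, s.mem (8 + (N + (N + i))) = c * s'.mem (8 + (N + (N + i))) := by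
  refine Ends.ite (k₁ := 30) ?_ ?_ (by decide)
  · intro hb
    simp only [TestExpr.holds, RealExpr.eval, IdxExpr.eval, Nat.cast_zero] at hb
    exact Ends.skip (by decide) ⟨rfl, fun _ _ _ => rfl, hb, h5, hw, 1, fun i _ => (one_mul _).symm⟩
  · intro hb
    simp only [TestExpr.holds, RealExpr.eval, IdxExpr.eval, Nat.cast_zero, not_lt] at hb
    rw [h5] at hb
    have hz := (Finset.sum_eq_zero_iff_of_nonneg fun i hi => hw i (Finset.mem_range.1 hi)).1
      (le_antisymm hb (Finset.sum_nonneg fun i hi => hw i (Finset.mem_range.1 hi)))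
    have hz : ∀ i < N, s.mem (8 + (N + (N + i))) = 0 := fun i hi => hz i (Finset.mem_range.2 hi)
    refine Ends.seq (k₁ := 15) (k₂ := 15) (Ends.store (by decide) (Ends.store (by decide) ?_))
      le_rfl
    simp only [RealExpr.eval, IdxExpr.eval, h0, Nat.cast_one]
    have hv : ∀ i < N, Function.update (Function.update s.mem (8 + (N + N)) 1) 5 1
        (8 + (N + (N + i))) = if i = 0 then (1 : ℝ) else 0 := by
      intro i hi
      rw [Function.update_of_ne (by omega)]
      split_ifs with h
      · rw [h, add_zero, Function.update_self]
      · rw [Function.update_of_ne (by omega), hz i hi]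
    refine ⟨trivial, fun a ha ha' => ?_, by simp, ?_, fun i hi => ?_, 0, fun i hi => ?_⟩
    · rw [Function.update_of_ne ha, Function.update_of_ne (by omega)]
    · rw [Finset.sum_congr rfl fun i hi => hv i (Finset.mem_range.1 hi), Function.update_self,
        Finset.sum_ite_eq', if_pos (Finset.mem_range.2 hN)]
    · rw [hv i hi]; split_ifs <;> norm_num
    · rw [hz i hi, zero_mul]

theorem ends_evalOutcome {N j : ℕ} (h0 : s.regs 0 = N) (h2 : s.regs 2 = j) :
    Ends F evalOutcome s (100 * (N + 1)) fun s' =>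
      (∀ r ≠ 1, s'.regs r = s.regs r) ∧ (∀ a ≠ 6, s'.mem a = s.mem a) ∧
      s'.mem 6 = ∑ i ∈ Finset.range N, s.mem (8 + (N + (N + i))) *
        F (s.mem (8 + (N + (N + (N + i))))) (s.mem 0 * j / N - s.mem 0) := by
  refine Ends.seq (k₁ := 10) (k₂ := 90 * (N + 1)) (Ends.store (by decide) ?_) (by omega)
  refine (Ends.forLoop (k₁ := 70) N (fun i s' => s'.regs 1 = i ∧
      (∀ r ≠ 1, s'.regs r = s.regs r) ∧ (∀ a ≠ 6, s'.mem a = s.mem a) ∧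
      s'.mem 6 = ∑ i ∈ Finset.range i, s.mem (8 + (N + (N + i))) *
        F (s.mem (8 + (N + (N + (N + i))))) (s.mem 0 * j / N - s.mem 0))
      ?_ ?_ ?_ ?_).mono le_rfl ?_
  · rintro i s' ⟨h1, hr, -⟩
    exact ⟨h1, by simp [IdxExpr.eval, hr, h0]⟩
  · rintro i hi s' ⟨h1, hr, hm, h6⟩
    have hr0 : s'.regs 0 = N := by rw [hr 0 (by decide), h0]
    have hr2 : s'.regs 2 = j := by rw [hr 2 (by decide), h2]
    refine Ends.store (by decide) ?_
    simp only [RealExpr.eval, IdxExpr.eval, weightIdx, pointIdx, outcomeExpr, hr0, h1, hr2]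
    refine ⟨by simp, fun r hr1 => ?_, fun a ha => ?_, ?_⟩
    · rw [Function.update_of_ne hr1, hr r hr1]
    · rw [Function.update_of_ne ha, hm a ha]
    · rw [Function.update_self, h6, Finset.sum_range_succ, hm _ (by omega), hm _ (by omega),
        hm 0 (by omega)]
  · refine ⟨by simp, fun r hr => by simp [hr], fun a ha => ?_, ?_⟩
    · simp only [IdxExpr.eval]; rw [Function.update_of_ne ha]
    · simp [IdxExpr.eval, RealExpr.eval]
  · simp only [IdxExpr.cost]; omega
  · rintro s' ⟨-, h⟩
    exact h

theorem ends_bestResponse {N : ℕ} (h0 : s.regs 0 = N) {v : ℕ → ℝ}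
    (hv : ∀ j, v j = ∑ i ∈ Finset.range N, s.mem (8 + (N + (N + i))) *
        F (s.mem (8 + (N + (N + (N + i))))) (s.mem 0 * j / N - s.mem 0)) :
    Ends F bestResponse s (500 * (N + 1) ^ 2) fun s' =>
      (∀ r, r ≠ 1 → r ≠ 2 → r ≠ 4 → s'.regs r = s.regs r) ∧
      (∀ a, a ≠ 6 → a ≠ 7 → s'.mem a = s.mem a) ∧
      s'.regs 4 < 1 + (N + N) ∧ s'.mem 7 = v (s'.regs 4) ∧
      ∀ j < 1 + (N + N), v j ≤ s'.mem 7 := by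
  refine Ends.seq (k₁ := 2) (k₂ := 300 * (N + 1) ^ 2 + 100 * (N + 1) + 7)
    (Ends.setReg (by decide) ?_) (by nlinarith)
  refine Ends.seq (k₁ := 2) (k₂ := 300 * (N + 1) ^ 2 + 100 * (N + 1) + 5)
    (Ends.setReg (by decide) ?_) (by omega)
  refine Ends.seq (k₁ := 100 * (N + 1)) (k₂ := 300 * (N + 1) ^ 2 + 5)
    ((ends_evalOutcome (N := N) (j := 0) (by simpa using h0) (by simp [IdxExpr.eval])).mono le_rfl
      ?_) (by omega)
  rintro s₁ ⟨hr₁, hm₁, h6₁⟩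
  simp only [IdxExpr.eval] at hr₁ hm₁ h6₁
  rw [← hv 0] at h6₁
  refine Ends.seq (k₁ := 5) (k₂ := 300 * (N + 1) ^ 2) (Ends.store (by decide) ?_) (by omega)
  refine (Ends.forLoop (k₁ := 100 * (N + 1) + 30) (1 + (N + N)) (fun i s' => s'.regs 2 = i ∧
      (∀ r, r ≠ 1 → r ≠ 2 → r ≠ 4 → s'.regs r = s.regs r) ∧
      (∀ a, a ≠ 6 → a ≠ 7 → s'.mem a = s.mem a) ∧
      s'.regs 4 < 1 + (N + N) ∧ s'.mem 7 = v (s'.regs 4) ∧ ∀ j < i, v j ≤ s'.mem 7)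
      ?_ ?_ ?_ ?_).mono le_rfl ?_
  · rintro i s' ⟨h1, hr, -⟩
    exact ⟨h1, by simp [IdxExpr.eval, hr, h0]⟩
  · rintro i hi s' ⟨h2, hr, hm, h4, h7, hle⟩
    have hr0 : s'.regs 0 = N := by rw [hr 0 (by decide) (by decide) (by decide), h0]
    refine Ends.seq (k₁ := 100 * (N + 1)) (k₂ := 30)
      ((ends_evalOutcome (N := N) (j := i) hr0 h2).mono le_rfl ?_) le_rfl
    rintro s₂ ⟨hr₂, hm₂, h6₂⟩
    have h6₂ : s₂.mem 6 = v i := by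
      rw [h6₂, hv i, hm 0 (by omega) (by omega)]
      refine Finset.sum_congr rfl fun i _ => ?_
      rw [hm _ (by omega) (by omega), hm _ (by omega) (by omega)]
    have hframe : ∀ a, a ≠ 6 → a ≠ 7 → s₂.mem a = s.mem a := fun a h h' => by
      rw [hm₂ a h, hm a h h']
    have hreg : ∀ r, r ≠ 1 → r ≠ 2 → r ≠ 4 → s₂.regs r = s.regs r := fun r h h' h'' => by
      rw [hr₂ r h, hr r h h' h'']
    have hr22 : s₂.regs 2 = i := by rw [hr₂ 2 (by decide), h2]
    have h77 : s₂.mem 7 = s'.mem 7 := hm₂ 7 (by decide)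
    have h44 : s₂.regs 4 = s'.regs 4 := hr₂ 4 (by decide)
    refine Ends.ite (k₁ := 20) ?_ ?_ (by decide)
    · intro hb
      simp only [TestExpr.holds, RealExpr.eval, IdxExpr.eval, h6₂, h77] at hb
      refine Ends.seq (k₁ := 10) (k₂ := 10) (Ends.store (by decide) (Ends.setReg (by decide) ?_))
        le_rfl
      simp only [RealExpr.eval, IdxExpr.eval, hr22, h6₂]
      refine ⟨by simp [hr22], fun r h h' h'' => ?_, fun a h h' => ?_, by simpa using hi, by simp,
        fun j hj => ?_⟩
      · rw [Function.update_of_ne h', Function.update_of_ne h'', hreg r h h' h'']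
      · rw [Function.update_of_ne h', hframe a h h']
      · rw [Function.update_self]
        rcases Nat.lt_succ_iff_lt_or_eq.1 hj with hj | rfl
        · exact (hle j hj).trans hb.le
        · exact le_rfl
    · intro hb
      simp only [TestExpr.holds, RealExpr.eval, IdxExpr.eval, h6₂, h77, not_lt] at hb
      refine Ends.skip (by decide) ?_
      refine ⟨by simp [hr22], fun r h h' h'' => ?_, hframe, by simpa [h44] using h4,
        by simpa [h44, h77] using h7, fun j hj => ?_⟩
      · dsimp only
        rw [Function.update_of_ne h', hreg r h h' h'']
      · dsimp only
        rw [h77]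
        rcases Nat.lt_succ_iff_lt_or_eq.1 hj with hj | rfl
        · exact hle j hj
        · exact hb
  · have h40 : s₁.regs 4 = 0 := by rw [hr₁ 4 (by decide)]; simp
    refine ⟨by simp, fun r h h' h'' => ?_, fun a h h' => ?_, ?_, ?_, fun j hj => absurd hj (by omega)⟩
    · dsimp only
      rw [Function.update_of_ne h', hr₁ r h, Function.update_of_ne h', Function.update_of_ne h'']
    · simp only [IdxExpr.eval]
      rw [Function.update_of_ne h', hm₁ a h]
    · simp only [Function.update_of_ne (show (4 : ℕ) ≠ 2 by decide), h40]; omega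
    · simp only [RealExpr.eval, IdxExpr.eval, Function.update_self,
        Function.update_of_ne (show (4 : ℕ) ≠ 2 by decide), h40, h6₁]
  · simp only [IdxExpr.cost]
    calc _ = 200 * (N + 1) ^ 2 + 84 * (N + 1) := by ring
      _ ≤ 200 * (N + 1) ^ 2 + 100 * (N + 1) ^ 2 := by
          gcongr
          · norm_num
          · exact Nat.le_self_pow two_ne_zero _
      _ = 300 * (N + 1) ^ 2 := by ring
  · rintro s' ⟨-, h⟩
    exact h

theorem ends_updateRegrets {N j : ℕ} (h0 : s.regs 0 = N) (h4 : s.regs 4 = j) :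
    Ends F updateRegrets s (150 * (N + 1)) fun s' =>
      (∀ r ≠ 1, s'.regs r = s.regs r) ∧
      (∀ a, (a < 8 ∨ 8 + (N + N) ≤ a) → s'.mem a = s.mem a) ∧
      (∀ i < N, s'.mem (8 + i) = s.mem (8 + i) + s.mem (8 + (N + (N + i))) / s.mem 5) ∧
      ∀ i < N, s'.mem (8 + (N + i)) = s.mem (8 + (N + i)) + (s.mem 7 / s.mem 5 -
        F (s.mem (8 + (N + (N + (N + i))))) (s.mem 0 * j / N - s.mem 0)) := by
  refine (Ends.forLoop (k₁ := 100) N (fun i s' => s'.regs 1 = i ∧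
      (∀ r ≠ 1, s'.regs r = s.regs r) ∧
      (∀ a, (a < 8 ∨ (8 + i ≤ a ∧ a < 8 + N) ∨ 8 + (N + i) ≤ a) → s'.mem a = s.mem a) ∧
      (∀ k < i, s'.mem (8 + k) = s.mem (8 + k) + s.mem (8 + (N + (N + k))) / s.mem 5) ∧
      ∀ k < i, s'.mem (8 + (N + k)) = s.mem (8 + (N + k)) + (s.mem 7 / s.mem 5 -
        F (s.mem (8 + (N + (N + (N + k))))) (s.mem 0 * j / N - s.mem 0)))
      ?_ ?_ ?_ ?_).mono le_rfl ?_
  · rintro i s' ⟨h1, hr, -⟩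
    exact ⟨h1, by simp [IdxExpr.eval, hr, h0]⟩
  · rintro i hi s' ⟨h1, hr, hm, hA, hR⟩
    have hr0 : s'.regs 0 = N := by rw [hr 0 (by decide), h0]
    have hr4 : s'.regs 4 = j := by rw [hr 4 (by decide), h4]
    refine Ends.seq (k₁ := 40) (k₂ := 60) (Ends.store (by decide) (Ends.store (by decide) ?_))
      le_rfl
    simp only [RealExpr.eval, IdxExpr.eval, weightIdx, pointIdx, regretIdx, actionIdx, outcomeExpr,
      hr0, h1, hr4]
    refine ⟨by simp, fun r hr1 => ?_, fun a ha => ?_, fun k hk => ?_, fun k hk => ?_⟩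
    · rw [Function.update_of_ne hr1, hr r hr1]
    · rw [Function.update_of_ne (by omega), Function.update_of_ne (by omega), hm a (by omega)]
    · rw [Function.update_of_ne (by omega)]
      rcases Nat.lt_succ_iff_lt_or_eq.1 hk with hk | rfl
      · rw [Function.update_of_ne (by omega), hA k hk]
      · rw [Function.update_self, hm _ (by omega), hm _ (by omega), hm _ (by omega)]
    · rcases Nat.lt_succ_iff_lt_or_eq.1 hk with hk | rfl
      · rw [Function.update_of_ne (by omega), Function.update_of_ne (by omega), hR k hk]
      · have hn : ∀ a, (a < 8 ∨ 8 + (N + k) ≤ a) →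
            Function.update s'.mem (8 + k) (s'.mem (8 + k) + s'.mem (8 + (N + (N + k))) / s'.mem 5)
              a = s.mem a := fun a ha => by
          rw [Function.update_of_ne (by omega), hm a (by omega)]
        rw [Function.update_self, hn _ (by omega), hn _ (by omega), hn _ (by omega),
          hn _ (by omega), hn _ (by omega)]
  · exact ⟨by simp, fun r hr => by simp [hr], fun _ _ => rfl, fun _ hk => absurd hk (by omega),
      fun _ hk => absurd hk (by omega)⟩
  · simp only [IdxExpr.cost]; omega
  · rintro s' ⟨-, hr, hm, h⟩
    exact ⟨hr, fun a ha => hm a (by omega), h⟩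

theorem ends_writeAverage {N t : ℕ} (h0 : s.regs 0 = N) (h3 : s.regs 3 = t) :
    Ends F writeAverage s (50 * (N + 1)) fun s' => ∀ i < N, s'.mem i = s.mem (8 + i) / t := by
  refine (Ends.forLoop (k₁ := 40) N (fun i s' => s'.regs 1 = i ∧
      (∀ r ≠ 1, s'.regs r = s.regs r) ∧ (∀ a, i ≤ a → s'.mem a = s.mem a) ∧
      ∀ k < i, s'.mem k = s.mem (8 + k) / t)
      ?_ ?_ ?_ ?_).mono le_rfl ?_
  · rintro i s' ⟨h1, hr, -⟩
    exact ⟨h1, by simp [IdxExpr.eval, hr, h0]⟩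
  · rintro i hi s' ⟨h1, hr, hm, hA⟩
    have hr3 : s'.regs 3 = t := by rw [hr 3 (by decide), h3]
    refine Ends.store (by decide) ?_
    simp only [RealExpr.eval, IdxExpr.eval, actionIdx, h1, hr3]
    refine ⟨by simp, fun r hr1 => ?_, fun a ha => ?_, fun k hk => ?_⟩
    · rw [Function.update_of_ne hr1, hr r hr1]
    · rw [Function.update_of_ne (by omega), hm a (by omega)]
    · rcases Nat.lt_succ_iff_lt_or_eq.1 hk with hk | rfl
      · rw [Function.update_of_ne (by omega), hA k hk]
      · rw [Function.update_self, hm _ (by omega)]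
  · exact ⟨by simp, fun r hr => by simp [hr], fun _ _ => rfl, fun _ hk => absurd hk (by omega)⟩
  · simp only [IdxExpr.cost]; omega
  · rintro s' ⟨-, -, -, h⟩
    exact h

end Specifications

/-! ### Correctness of the program -/

/-- Average payoff of a mixed action against a multiset of opponent actions. -/
theorem sum_mul_multiset_sum_le {N : ℕ} {ι : Type*} {F : Fin N → ι → ℝ} {ν : Fin N → ℝ} {c : ℝ}
    (hc : ∀ y, ∑ i, ν i * F i y ≤ c) (ys : Multiset ι) :
    ∑ i, ν i * (ys.map (F i)).sum ≤ c * ys.card := by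
  induction ys using Multiset.induction_on with
  | empty => simp
  | cons y ys ih =>
    simp only [Multiset.map_cons, Multiset.sum_cons, mul_add, Finset.sum_add_distrib,
      Multiset.card_cons, Nat.cast_add, Nat.cast_one, mul_one]
    linarith [hc y]

/-- Averaging the bounds for pure actions with the weights `ν` compares the output with an arbitrary
mixed action directly, without the minimax theorem. -/
theorem RegretState.average_le {N : ℕ} {ι : Type*} {F : Fin N → ι → ℝ} {H δ η : ℝ} {t : ℕ}
    {A R : Fin N → ℝ} (h : RegretState F H δ t A R) (hη : 0 ≤ η) (ht0 : 0 < t)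
    (ht : 4 * H ^ 2 * N ≤ η ^ 2 * t) {ν : Fin N → ℝ} (hν : ν ∈ stdSimplex ℝ (Fin N)) {c : ℝ}
    (hc : ∀ y, ∑ i, ν i * F i y ≤ c) (y : ι) : ∑ i, A i / t * F i y ≤ c + (δ + η) := by
  obtain ⟨ys, hys, hb⟩ := h.bound hη ht
  have ht0' : (0 : ℝ) < t := by exact_mod_cast ht0
  have h1 : ∑ i, A i / t * F i y = (∑ i, A i * F i y) / t := by
    rw [Finset.sum_div]; exact Finset.sum_congr rfl fun i _ => by ring
  have h2 : ∑ i, A i * F i y - (δ + η) * t ≤ ∑ i, ν i * (ys.map (F i)).sum := by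
    calc ∑ k, A k * F k y - (δ + η) * t
        = ∑ i, ν i * (∑ k, A k * F k y - (δ + η) * t) := by
          rw [← Finset.sum_mul, hν.2, one_mul]
      _ ≤ _ := Finset.sum_le_sum fun i _ =>
          mul_le_mul_of_nonneg_left (by linarith [hb i y]) (hν.1 i)
  have h3 := sum_mul_multiset_sum_le hc ys
  rw [hys] at h3
  rw [h1, div_le_iff₀ ht0']
  linarith

/-- The invariant of the main loop. -/
structure MatchingInvariant {N : ℕ} (F : ℝ → ℝ → ℝ) (B H ε₂ : ℝ) (z : Fin N → ℝ) (t : ℕ)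
    (s : MachineState) : Prop where
  size : s.regs 0 = N
  round : s.regs 3 = t
  mem_zero : s.mem 0 = B
  mem_two : s.mem 2 = H
  mem_four : s.mem 4 = ε₂
  point : ∀ i : Fin N, s.mem (8 + (N + (N + (N + i)))) = z i
  regret : RegretState (fun i (j : Fin (1 + (N + N))) => F (z i) (B * (j : ℕ) / N - B)) H 0 t
    (fun i => s.mem (8 + i)) (fun i => s.mem (8 + (N + i)))

section Specifications

open Program

variable {F : ℝ → ℝ → ℝ} {s : MachineState}

theorem ends_matchingRound {N : ℕ} (hN : 0 < N) {B H ε₂ : ℝ} {z : Fin N → ℝ} {t : ℕ}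
    (hF : ∀ (i : Fin N) (j : Fin (1 + (N + N))), |F (z i) (B * (j : ℕ) / N - B)| ≤ H)
    (hs : MatchingInvariant F B H ε₂ z t s) :
    Ends F matchingRound s (1000 * (N + 1) ^ 2) (MatchingInvariant F B H ε₂ z (t + 1)) := by
  have hsq : N + 1 ≤ (N + 1) ^ 2 := Nat.le_self_pow two_ne_zero _
  refine Ends.seq (k₁ := 100 * (N + 1)) (k₂ := 50 + (500 * (N + 1) ^ 2 + (150 * (N + 1) + 4)))
    ((ends_writePositiveParts hs.size).mono le_rfl ?_) (by omega)
  rintro s₁ ⟨hr₁, hm₁, h5₁, hw₁⟩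
  have h0₁ : s₁.regs 0 = N := by rw [hr₁ 0 (by decide), hs.size]
  refine Ends.seq ((ends_fixWeights hN h0₁ ?_ ?_).mono le_rfl ?_) le_rfl
  · rw [h5₁]
    exact Finset.sum_congr rfl fun i hi => (hw₁ i (Finset.mem_range.1 hi)).symm
  · intro i hi; rw [hw₁ i hi]; exact le_max_right _ _
  rintro s₂ ⟨hr₂, hm₂, h5₂, hsum₂, hw₂, c, hc₂⟩
  have h0₂ : s₂.regs 0 = N := by rw [hr₂, h0₁]
  have hf₂ : ∀ a ≠ 5, (a < 8 + (N + N) ∨ 8 + (N + (N + N)) ≤ a) → s₂.mem a = s.mem a :=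
    fun a h h' => by rw [hm₂ a h h', hm₁ a h h']
  have hz₂ : ∀ i : Fin N, s₂.mem (8 + (N + (N + (N + i)))) = z i := fun i => by
    rw [hf₂ _ (by omega) (by omega), hs.point]
  have hB₂ : s₂.mem 0 = B := by rw [hf₂ 0 (by omega) (by omega), hs.mem_zero]
  refine Ends.seq ((ends_bestResponse h0₂ fun _ => rfl).mono le_rfl ?_) le_rfl
  rintro s₃ ⟨hr₃, hm₃, h4₃, h7₃, hle₃⟩
  have h0₃ : s₃.regs 0 = N := by rw [hr₃ 0 (by decide) (by decide) (by decide), h0₂]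
  have h5₃ : s₃.mem 5 = s₂.mem 5 := hm₃ 5 (by decide) (by decide)
  refine Ends.seq ((ends_updateRegrets h0₃ rfl).mono le_rfl ?_) le_rfl
  rintro s₄ ⟨hr₄, hm₄, hA₄, hR₄⟩
  refine Ends.setReg (by decide) ?_
  have h3₄ : s₄.regs 3 = t := by
    rw [hr₄ 3 (by decide), hr₃ 3 (by decide) (by decide) (by decide), hr₂, hr₁ 3 (by decide),
      hs.round]
  have hframe : ∀ a, (a < 5 ∨ 8 + (N + (N + N)) ≤ a) → s₄.mem a = s.mem a := fun a ha => by
    rw [hm₄ a (by omega), hm₃ a (by omega) (by omega), hf₂ a (by omega) (by omega)]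
  refine ⟨?_, by simp [IdxExpr.eval, h3₄], ?_, ?_, ?_, fun i => ?_, ?_⟩
  · simp only [IdxExpr.eval]
    rw [Function.update_of_ne (by decide), hr₄ 0 (by decide), h0₃]
  · exact (hframe 0 (by omega)).trans hs.mem_zero
  · exact (hframe 2 (by omega)).trans hs.mem_two
  · exact (hframe 4 (by omega)).trans hs.mem_four
  · exact (hframe _ (by omega)).trans (hs.point i)
  have hval : ∀ j : ℕ, ∑ i : Fin N, s₂.mem (8 + (N + (N + i))) / s₂.mem 5 *
      F (z i) (B * j / N - B) = (∑ i ∈ Finset.range N, s₂.mem (8 + (N + (N + i))) *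
        F (s₂.mem (8 + (N + (N + (N + i))))) (s₂.mem 0 * j / N - s₂.mem 0)) / s₂.mem 5 := by
    intro j
    rw [Finset.sum_div, Finset.sum_range]
    exact Finset.sum_congr rfl fun i _ => by rw [hz₂ i, hB₂]; ring
  -- There are finitely many outcomes here, so the best reply is exact and `δ = 0`.
  have hstep := hs.regret.step hF (μ := fun i => s₂.mem (8 + (N + (N + i))) / s₂.mem 5)
    ⟨fun i => div_nonneg (hw₂ i i.2) h5₂.le, by
      rw [← Finset.sum_div, div_eq_one_iff_eq h5₂.ne', hsum₂, Finset.sum_range]⟩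
    (S := c * s₂.mem 5) (fun i => by
      rw [mul_assoc, mul_div_cancel₀ _ h5₂.ne', ← hc₂ i i.2, hw₁ i i.2])
    (y := ⟨s₃.regs 4, h4₃⟩) (fun j => by
      rw [add_zero, hval, hval, ← h7₃]
      exact div_le_div_of_nonneg_right (hle₃ j j.2) h5₂.le)
  convert hstep using 1
  · funext i
    dsimp only
    rw [hA₄ i i.2, h5₃, hm₃ _ (by omega) (by omega), hm₃ _ (by omega) (by omega),
      hf₂ (8 + i) (by omega) (by omega)]
  · funext i
    dsimp only
    rw [hval, ← h7₃, hR₄ i i.2, h5₃, hm₃ (8 + (N + i)) (by omega) (by omega),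
      hm₃ (8 + (N + (N + (N + i)))) (by omega) (by omega), hm₃ 0 (by omega) (by omega), hz₂, hB₂, hf₂ (8 + (N + i)) (by omega) (by omega)]

/-- Number of rounds of regret matching. -/
noncomputable def matchingRounds (N : ℕ) (H ε₂ : ℝ) : ℕ := ⌈(16 * H ^ 2 + 1) * N / ε₂ ^ 2⌉₊

theorem ends_matching {N : ℕ} (hN : 0 < N) {B H ε₂ : ℝ} (hε : 0 < ε₂) {z : Fin N → ℝ}
    (hF : ∀ (i : Fin N) (j : Fin (1 + (N + N))), |F (z i) (B * (j : ℕ) / N - B)| ≤ H)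
    (hs : MatchingInvariant F B H ε₂ z 0 s) :
    Ends F matching s (1100 * (matchingRounds N H ε₂ + 1) * (N + 1) ^ 2)
      (MatchingInvariant F B H ε₂ z (matchingRounds N H ε₂)) := by
  have htest : ∀ (t : ℕ) (s : MachineState), MatchingInvariant F B H ε₂ z t s →
      ((TestExpr.realLt (.mul (.ofIdx (.reg 3)) (.mul (.load (.const 4)) (.load (.const 4))))
        (.mul (.add (.mul (.ofIdx (.const 16)) (.mul (.load (.const 2)) (.load (.const 2))))
        (.ofIdx (.const 1))) (.ofIdx (.reg 0)))).holds F s ↔ t < matchingRounds N H ε₂) := by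
    intro t s hs
    rw [matchingRounds, Nat.lt_ceil, lt_div_iff₀ (by positivity)]
    simp only [TestExpr.holds, RealExpr.eval, IdxExpr.eval, hs.size, hs.round, hs.mem_two,
      hs.mem_four, Nat.cast_one, Nat.cast_ofNat]
    rw [pow_two, pow_two]
  refine Ends.loop (k₁ := 1000 * (N + 1) ^ 2) (matchingRounds N H ε₂)
    (MatchingInvariant F B H ε₂ z) (fun t ht s hs => ⟨(htest t s hs).2 ht,
      ends_matchingRound hN hF hs⟩) (fun s hs => by rw [htest _ s hs]; exact lt_irrefl _) hs ?_
  have hsq : 1 ≤ (N + 1) ^ 2 := Nat.one_le_pow _ _ (by omega)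
  simp only [TestExpr.cost, RealExpr.cost, IdxExpr.cost]
  generalize (N + 1) ^ 2 = M at hsq ⊢
  generalize matchingRounds N H ε₂ = T
  nlinarith [Nat.mul_le_mul_left T hsq]

/-- The program computes the average of the mixed actions of regret matching. -/
theorem ends_solver {B K H ε₁ ε₂ : ℝ} (hB : 0 < B) (hε₁ : 0 < ε₁) (hε₂ : 0 < ε₂)
    (hF : ∀ y ∈ Set.Icc (-B) B, ∀ z ∈ Set.Icc (-B) B, |F z y| ≤ H) {N T : ℕ}
    (hN : N = gridSize B ε₁) (hT : T = matchingRounds N H ε₂)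
    (hgrid : ∀ j : Fin (1 + (N + N)), B * (j : ℕ) / N - B ∈ Set.Icc (-B) B) :
    Ends F solver (initialState [B, K, H, ε₁, ε₂]) (2000 * (T + 1) * (N + 1) ^ 2) fun s' =>
      ∃ A R, RegretState (fun (i : Fin (gridSize B ε₁)) (j : Fin (1 + (N + N))) =>
          F (gridPoint B ε₁ i) (B * (j : ℕ) / N - B)) H 0 T A R ∧
        ∀ i : Fin (gridSize B ε₁), s'.mem i = A i / T := by
  subst hN
  set N := gridSize B ε₁ with hN
  have hNpos : 0 < N := gridSize_pos hB hε₁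
  have hsq : N + 1 ≤ (T + 1) * (N + 1) ^ 2 :=
    (Nat.le_self_pow two_ne_zero _).trans (Nat.le_mul_of_pos_left _ (Nat.succ_pos T))
  refine Ends.seq (k₁ := 20 * (N + 1))
    (k₂ := 100 * (N + 1) + (1100 * (T + 1) * (N + 1) ^ 2 + 50 * (N + 1)))
    ((ends_countPoints (B := B) (ε := ε₁) rfl rfl rfl).mono le_rfl ?_) (by linarith)
  rintro s₁ ⟨hm₁, hr₁⟩
  refine Ends.seq ((ends_writePoints (N := N) (B := B) (ε := ε₁) (by rw [hr₁, Function.update_self])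
    (by rw [hm₁]; rfl) (by rw [hm₁]; rfl)).mono le_rfl ?_) le_rfl
  rintro s₂ ⟨hr₂, hm₂, hz₂⟩
  have hm : ∀ a < 8 + (N + (N + N)), s₂.mem a = (initialState [B, K, H, ε₁, ε₂]).mem a :=
    fun a ha => by rw [hm₂ a ha, hm₁]
  -- Cells from `8` on lie beyond the five inputs, and their default value zero is the initial state
  -- of regret matching.
  have hzero : ∀ a, 8 ≤ a → a < 8 + (N + (N + N)) → s₂.mem a = 0 := fun a ha ha' => by
    rw [hm a ha']
    exact List.getD_eq_default _ _ (by simp; omega)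
  have hinv : MatchingInvariant F B H ε₂ (gridPoint B ε₁) 0 s₂ := by
    refine ⟨?_, ?_, hm 0 (by omega), hm 2 (by omega), hm 4 (by omega), fun i => ?_, ?_⟩
    · rw [hr₂ 0 (by decide), hr₁, Function.update_self]
    · rw [hr₂ 3 (by decide), hr₁, Function.update_of_ne (by decide)]; rfl
    · rw [hz₂ i i.2]; rfl
    · convert RegretState.zero _ H 0 using 1
      · funext i; exact hzero _ (by omega) (by omega)
      · funext i; exact hzero _ (by omega) (by omega)
  rw [hT]
  refine Ends.seq ((ends_matching hNpos hε₂
    (fun i j => hF _ (hgrid j) _ (gridPoint_mem hB hε₁ i)) hinv).mono le_rfl ?_) le_rfl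
  intro s₃ hs₃
  exact (ends_writeAverage hs₃.size hs₃.round).mono le_rfl fun s₄ h₄ =>
    ⟨_, _, hs₃.regret, fun i => h₄ i i.2⟩

end Specifications

/-! ### Restriction to finitely many outcomes, and precision of the output. -/

/-- The maximum over the outcomes `-B + B j / N` for `j ≤ 2 N` is almost the supremum over
`[-B, B]` of a function which is Lipschitz or convex. -/
theorem exists_le_add_of_lipschitz_or_convex {B K e : ℝ} {N : ℕ} (hB : 0 < B) (hN : 0 < N)
    (he : 0 ≤ e) (hK : 0 ≤ K) (hKN : K * (B / N) ≤ e) {g : ℝ → ℝ}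
    (hg : (∀ a ∈ Set.Icc (-B) B, ∀ b ∈ Set.Icc (-B) B, |g a - g b| ≤ K * |a - b|) ∨
      ConvexOn ℝ (Set.Icc (-B) B) g)
    (hgrid : ∀ j : Fin (1 + (N + N)), B * (j : ℕ) / N - B ∈ Set.Icc (-B) B)
    {y : ℝ} (hy : y ∈ Set.Icc (-B) B) :
    ∃ j : Fin (1 + (N + N)), g y ≤ g (B * (j : ℕ) / N - B) + e := by
  have hN' : (0 : ℝ) < N := by exact_mod_cast hN
  rcases hg with hg | hg
  · have h0 : 0 ≤ (y + B) * N / B := by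
      have := hy.1
      have : 0 ≤ y + B := by linarith
      positivity
    have h1 : (y + B) * N / B ≤ ((N + N : ℕ) : ℝ) := by
      rw [div_le_iff₀ hB]; push_cast; nlinarith [hy.2]
    refine ⟨⟨⌊(y + B) * N / B⌋₊, ?_⟩, ?_⟩
    · have := Nat.floor_le_of_le h1; omega
    set j := ⌊(y + B) * N / B⌋₊ with hj
    have hlow : (j : ℝ) ≤ (y + B) * N / B := Nat.floor_le h0
    have hup : (y + B) * N / B < j + 1 := Nat.lt_floor_add_one _
    have hj' : j < 1 + (N + N) := by have := Nat.floor_le_of_le h1; omega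
    have h2 : |y - (B * j / N - B)| ≤ B / N := by
      rw [le_div_iff₀ hB] at hlow
      rw [div_lt_iff₀ hB] at hup
      have e1 : y - (B * j / N - B) = ((y + B) * N - B * j) / N := by field_simp; ring
      rw [e1, abs_of_nonneg (div_nonneg (by linarith) hN'.le)]
      exact div_le_div_of_nonneg_right (by linarith) hN'.le
    have h3 := (abs_le.1 (hg y hy _ (hgrid ⟨j, hj'⟩))).2
    have h4 := mul_le_mul_of_nonneg_left h2 hK
    dsimp only at h3 ⊢
    linarith
  -- A convex function on an interval is largest at an endpoint, and both endpoints are among the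
  -- outcomes, as `j = 0` and `j = 2N`.
  · have h := hg.le_max_of_mem_Icc (Set.left_mem_Icc.2 (by linarith))
      (Set.right_mem_Icc.2 (by linarith)) hy
    rcases le_max_iff.1 h with h | h
    · refine ⟨⟨0, by omega⟩, ?_⟩
      simpa using h.trans (le_add_of_nonneg_right he)
    · refine ⟨⟨N + N, by omega⟩, ?_⟩
      have : B * ((N + N : ℕ) : ℝ) / N - B = B := by push_cast; field_simp; ring
      dsimp only
      rw [this]
      linarith

theorem grid_outcome_mem {B : ℝ} {N : ℕ} (hB : 0 < B) (hN : 0 < N) (j : Fin (1 + (N + N))) :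
    B * (j : ℕ) / N - B ∈ Set.Icc (-B) B := by
  have hN' : (0 : ℝ) < N := by exact_mod_cast hN
  have hj : ((j : ℕ) : ℝ) ≤ N + N := by exact_mod_cast Nat.lt_one_add_iff.1 j.2
  constructor
  · have : 0 ≤ B * (j : ℕ) / N := by positivity
    linarith
  · rw [sub_le_iff_le_add, div_le_iff₀ hN']
    nlinarith

/-- The program solves the finite convex program approximately. -/
theorem exists_isApproxSolution_computesIn {F : ℝ → ℝ → ℝ} {B K H ε₁ ε₂ : ℝ} (hB : 0 < B)
    (hK : 0 ≤ K) (hε₁ : 0 < ε₁) (hε₂ : 0 < ε₂) (hKε : K * ε₁ ≤ ε₂)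
    (hF : ∀ y ∈ Set.Icc (-B) B, ∀ z ∈ Set.Icc (-B) B, |F z y| ≤ H)
    (hLC : (∀ z ∈ Set.Icc (-B) B, ∀ a ∈ Set.Icc (-B) B, ∀ b ∈ Set.Icc (-B) B,
      |F z a - F z b| ≤ K * |a - b|) ∨
      ∀ z ∈ Set.Icc (-B) B, ConvexOn ℝ (Set.Icc (-B) B) (F z)) :
    ∃ μ, IsApproxSolution B ε₁ ε₂ F μ ∧
      ∃ k ≤ 2000 * (matchingRounds (gridSize B ε₁) H ε₂ + 1) * (gridSize B ε₁ + 1) ^ 2,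
        ComputesIn Program.solver F [B, K, H, ε₁, ε₂] k μ := by
  set N := gridSize B ε₁ with hN
  set T := matchingRounds N H ε₂ with hT
  have hNpos : 0 < N := gridSize_pos hB hε₁
  have hN' : (0 : ℝ) < N := by exact_mod_cast hNpos
  have hgrid := fun j => grid_outcome_mem (N := N) hB hNpos j
  obtain ⟨k, hk, s', hexec, A, R, hreg, hmem⟩ :=
    ends_solver (K := K) hB hε₁ hε₂ hF hN hT hgrid
  -- With `η = ε₂ / 2`, the condition `4 H² N ≤ η² T` becomes `16 H² N ≤ ε₂² T`. The additional `N`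
  -- makes `T` positive even for `H = 0`.
  have hTle : (16 * H ^ 2 + 1) * N ≤ T * ε₂ ^ 2 := by
    rw [← div_le_iff₀ (by positivity)]; exact Nat.le_ceil _
  have hT0 : 0 < T := Nat.ceil_pos.2 (by positivity)
  have hμ := hreg.average_mem hT0
  refine ⟨fun i => A i / T, ⟨hμ, fun ν hν => ?_⟩, k, hk, s', hexec, hmem⟩
  have : Nonempty (Set.Icc (-B) B) := ⟨⟨B, Set.right_mem_Icc.2 (by linarith)⟩⟩
  refine ciSup_le fun y => ?_
  obtain ⟨j, hj⟩ := exists_le_add_of_lipschitz_or_convex (K := K) (e := ε₂ / 2) (N := N)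
    (g := fun y => ∑ i, A i / T * F (gridPoint B ε₁ i) y) hB hNpos (by linarith) hK (by
      -- The spacing of the outcomes is `B / N ≤ ε₁ / 2`, so rounding an outcome costs at most `K *
      -- ε₁ / 2 ≤ ε₂ / 2`.
      have h1 : 2 * B / ε₁ ≤ N := Nat.le_ceil _
      rw [div_le_iff₀ hε₁] at h1
      have h2 : B / N ≤ ε₁ / 2 := by rw [div_le_iff₀ hN']; linarith
      have h3 := mul_le_mul_of_nonneg_left h2 hK
      linarith) (by
      rcases hLC with h | h
      · left
        intro a ha b hb
        rw [← Finset.sum_sub_distrib]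
        simp only [← mul_sub]
        exact abs_weighted_sum_le hμ fun i => h _ (gridPoint_mem hB hε₁ i) a ha b hb
      · right
        refine ⟨convex_Icc _ _, fun a ha b hb p q hp hq hpq => ?_⟩
        simp only [smul_eq_mul, Finset.mul_sum, ← Finset.sum_add_distrib]
        refine Finset.sum_le_sum fun i _ => ?_
        have := (h _ (gridPoint_mem hB hε₁ i)).2 ha hb hp hq hpq
        simp only [smul_eq_mul] at this
        have := mul_le_mul_of_nonneg_left this (hμ.1 i)
        dsimp only at this
        linarith) hgrid y.2
  have hν' := hreg.average_le (η := ε₂ / 2) (by linarith) hT0 (by nlinarith) hν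
    (c := gridObjective B ε₁ F ν) (fun j =>
      le_ciSup (bddAbove_gridObjective hB hε₁ hF hν) ⟨_, hgrid j⟩) j
  linarith

/-! ### Running time and conclusion. -/

/-- The running time is polynomial. -/
theorem matching_time_le {B K H : ℝ} {n : ℕ} (hB : 0 < B) (hK : 0 < K) (hH : 0 ≤ H) (hn : 1 ≤ n) :
    ((n * (2000 * (matchingRounds (gridSize B (1 / (K * n))) H (1 / n) + 1) *
      (gridSize B (1 / (K * n)) + 1) ^ 2 + gridSize B (1 / (K * n)) + 1) : ℕ) : ℝ) ≤
      (3000000 : ℕ) * ((1 + B) * (1 + K) * (1 + H) * n) ^ 6 := by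
  have hn' : (1 : ℝ) ≤ n := by exact_mod_cast hn
  generalize hQ : (1 + B) * (1 + K) * (1 + H) * n = Q
  have hBK : B * K ≤ (1 + B) * (1 + K) := by nlinarith
  have hBK1 : 1 ≤ (1 + B) * (1 + K) := by nlinarith [mul_pos hB hK]
  have hnH : n ≤ (1 + H) * n := le_mul_of_one_le_left (by linarith) (by linarith)
  have hHQ : (1 + H) * n ≤ Q := by
    rw [← hQ, mul_assoc]; exact le_mul_of_one_le_left (by linarith) hBK1
  have hnQ : n ≤ Q := hnH.trans hHQ
  have hQ1 : 1 ≤ Q := hn'.trans hnQ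
  have hBKn : B * K * n ≤ Q := by
    rw [← hQ, mul_assoc _ (1 + H)]
    exact mul_le_mul hBK hnH (by linarith) (by linarith)
  set N := gridSize B (1 / (K * n)) with hN
  -- `N + 1 < 2BKn + 2 ≤ 4Q`. Similarly `T + 1 ≤ 64Q³ + 2` below, so a round takes `O(Q⁵)` steps,
  -- and `n ≤ Q` gives the sixth power.
  have hN1 : (N : ℝ) + 1 ≤ 4 * Q := by
    have h : (N : ℝ) < 2 * B / (1 / (K * n)) + 1 := Nat.ceil_lt_add_one (by positivity)
    rw [div_div_eq_mul_div, div_one] at h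
    linarith
  set T := matchingRounds N H (1 / n) with hT
  have hT1 : (T : ℝ) + 1 ≤ 66 * Q ^ 3 := by
    have h : (T : ℝ) < (16 * H ^ 2 + 1) * N / (1 / n) ^ 2 + 1 :=
      Nat.ceil_lt_add_one (by positivity)
    have e : (16 * H ^ 2 + 1) * N / (1 / n : ℝ) ^ 2 = (16 * H ^ 2 + 1) * n ^ 2 * N := by
      field_simp
    rw [e] at h
    have h1 : (16 * H ^ 2 + 1) * (n : ℝ) ^ 2 ≤ 16 * Q ^ 2 := by
      calc (16 * H ^ 2 + 1) * (n : ℝ) ^ 2 ≤ 16 * (1 + H) ^ 2 * n ^ 2 := by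
            apply mul_le_mul_of_nonneg_right _ (by positivity); nlinarith
        _ = 16 * ((1 + H) * n) ^ 2 := by ring
        _ ≤ 16 * Q ^ 2 := by
            have := pow_le_pow_left₀ (by linarith) hHQ 2
            linarith
    have h2 : (16 * H ^ 2 + 1) * (n : ℝ) ^ 2 * N ≤ 16 * Q ^ 2 * (4 * Q) :=
      mul_le_mul h1 (by linarith) (by positivity) (by positivity)
    have h3 : 1 ≤ Q ^ 3 := one_le_pow₀ hQ1
    nlinarith
  push_cast
  have h4 : ((T : ℝ) + 1) * (N + 1) ^ 2 ≤ 66 * Q ^ 3 * (4 * Q) ^ 2 :=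
    mul_le_mul hT1 (pow_le_pow_left₀ (by positivity) hN1 2) (by positivity) (by positivity)
  have h5 : Q ≤ Q ^ 5 := le_self_pow₀ hQ1 (by norm_num)
  have h6 : 2000 * ((T : ℝ) + 1) * (N + 1) ^ 2 + N + 1 ≤ 3000000 * Q ^ 5 := by
    have e : 66 * Q ^ 3 * (4 * Q) ^ 2 = 1056 * Q ^ 5 := by ring
    rw [e] at h4
    linarith
  calc (n : ℝ) * (2000 * (T + 1) * (N + 1) ^ 2 + N + 1) ≤ Q * (3000000 * Q ^ 5) :=
        mul_le_mul hnQ h6 (by positivity) (by linarith)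
    _ = 3000000 * Q ^ 6 := by ring

theorem mainTheorem12 :
    -- the regret inequality up to slack, for every choice of approximate solutions
    (∀ (X : Type u) (S : Type v) [AddCommGroup S] [Module ℝ S]
      (P : OnlineProblem X) (T : X → ℝ → ℝ → S) (V U : S → ℝ) (K H : ℕ → ℝ) (ε₁ ε₂ : ℝ)
      (σ : GridStrategy X (gridSize P.B ε₁)),
      P.IsSufficientPair T V → P.IsBurkholder T V U → P.LipschitzBounded T U K H →
      0 < ε₁ → 0 ≤ ε₂ → P.IsDiscretizedBurkholder T U ε₁ ε₂ σ →
      P.RegretAtMost ε₁ σ (ε₁ * ∑ t ∈ Finset.Icc 1 P.n, K t + ε₂ * P.n)) ∧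
    -- implementation by one program in polynomial time, with constant slack
    (∃ (c : Program) (C d : ℕ), ∀ (X : Type u) (S : Type v) [AddCommGroup S] [Module ℝ S]
      (P : OnlineProblem X) (T : X → ℝ → ℝ → S) (V U : S → ℝ) (K H : ℝ),
      P.IsSufficientPair T V → P.IsBurkholder T V U →
      0 < K → 0 ≤ H → P.LipschitzBounded T U (fun _ => K) (fun _ => H) →
      (P.OutcomeLipschitz T U K ∨ P.OutcomeConvex T U) → 1 ≤ P.n →
      ∃ (σ : GridStrategy X (gridSize P.B (1 / (K * P.n)))) (τ : ℕ),
        P.IsDiscretizedBurkholder T U (1 / (K * P.n)) (1 / P.n) σ ∧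
        P.ImplementedIn T U (1 / (K * P.n)) σ c [P.B, K, H, 1 / (K * P.n), 1 / P.n] τ ∧
        ((P.n * τ : ℕ) : ℝ) ≤ C * ((1 + P.B) * (1 + K) * (1 + H) * P.n) ^ d ∧
        P.RegretAtMost (1 / (K * P.n)) σ 2) := by
  refine ⟨fun X S _ _ P T V U K H ε₁ ε₂ σ hV hU hKH hε₁ _ hσ =>
    OnlineProblem.regretAtMost hV hU hKH hε₁ hσ, Program.solver, 3000000, 6, ?_⟩
  intro X S _ _ P T V U K H hV hU hK hH hKH hLC hn
  have hn' : (0 : ℝ) < P.n := by exact_mod_cast hn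
  have hε₁ : 0 < 1 / (K * (P.n : ℝ)) := by positivity
  have hround : ∀ (h : Transcript X) (x : X), ∃ μ : Fin (gridSize P.B (1 / (K * P.n))) → ℝ,
      h.length < P.n → P.Valid h →
      IsApproxSolution P.B (1 / (K * P.n)) (1 / P.n) (P.next T U (P.stat T h) x) μ ∧
      ∃ k ≤ 2000 * (matchingRounds (gridSize P.B (1 / (K * P.n))) H (1 / P.n) + 1) *
        (gridSize P.B (1 / (K * P.n)) + 1) ^ 2,
        ComputesIn Program.solver (P.next T U (P.stat T h) x)
          [P.B, K, H, 1 / (K * P.n), 1 / P.n] k μ := by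
    intro h x
    by_cases hh : h.length < P.n ∧ P.Valid h
    · obtain ⟨μ, hμ⟩ := exists_isApproxSolution_computesIn (F := P.next T U (P.stat T h) x)
        (K := K) (H := H) P.B_pos hK.le hε₁ (ε₂ := 1 / P.n) (by positivity)
        (le_of_eq (by field_simp))
        (fun y hy => (hKH (h.length + 1) (Finset.mem_Icc.2 ⟨by omega, hh.1⟩) h rfl hh.2 x y hy).2)
        (hLC.imp (fun hL => hL h hh.1 hh.2 x) (fun hC => hC h hh.1 hh.2 x))
      exact ⟨μ, fun _ _ => hμ⟩
    -- Weights on transcripts that are too long or invalid are arbitrary.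
    · exact ⟨fun _ => 0, fun h1 h2 => absurd ⟨h1, h2⟩ hh⟩
  choose σ hσ using hround
  have hσ' : P.IsDiscretizedBurkholder T U (1 / (K * P.n)) (1 / P.n) σ :=
    fun h hl hh x => (hσ h x hl hh).1
  refine ⟨σ, _, hσ', ?_, matching_time_le P.B_pos hK hH hn, ?_⟩
  · intro h hl hh x
    obtain ⟨k, hk, hc⟩ := (hσ h x hl hh).2
    exact ⟨k, by omega, hc⟩
  · have h := OnlineProblem.regretAtMost hV hU hKH hε₁ hσ'
    -- Discretization and optimization each contribute `1 / n` per round, hence `1` in total.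
    have e : 1 / (K * (P.n : ℝ)) * ∑ t ∈ Finset.Icc 1 P.n, K + 1 / (P.n : ℝ) * P.n = 2 := by
      rw [Finset.sum_const, Nat.card_Icc, Nat.add_sub_cancel, nsmul_eq_mul]
      field_simp
      norm_num
    rwa [e] at h
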